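/- Let $O=(Y,X,Z)$ have law $P$, with $Y,X$ real-valued and $Z$ in a measurable space, and let $v:\mathbb R\to\mathbb R$ be a known measurable function. For a law $Q$ of $O$ write $m(z)=E(Y|Z=z)$, $\pi(z)=E(X|Z=z)$, $\rho(z)=E\{v(X)|Z=z\}$, $\gamma(z)=\mathrm{Cov}\{v(X),Y|Z=z\}$, $\beta(z)=\mathrm{Cov}\{v(X),X|Z=z\}$, $\lambda(z)=\gamma(z)/\beta(z)$, $l(x|z)=\{v(x)-\rho(z)\}/\beta(z)$ (all under $Q$), and, with $(Y',X')$ an independent copy of $(Y,X)$ given $Z$, $\gamma_*(z)=E\{|v(X)-v(X')||Y-Y'|\,|\,Z=z\}$, $\beta_*(z)=E\{|v(X)-v(X')||X-X'|\,|\,Z=z\}$ (if $v$ is monotone on the support of $X$, then $\beta_*=2|\beta|$). A submodel through $P$ with score $s$ ($s$ bounded and measurable) is a family of laws $P_t$ which, for $t$ near $0$, have densities $1+ts+o(t)$ with respect to $P$, with $o(t)$ uniform. A function $\phi$ is an influence function of a functional $\Psi$ at $P$ in a nonparametric model $\mathcal M$ (a set of laws) if $E_P\phi(O)=0$, $E_P\phi(O)^2<\infty$,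 and along every submodel $P_t\in\mathcal M$ for $t$ near $0$ and $\frac{d}{dt}\Psi(P_t)\big|_{t=0}=E_P\{\phi(O)s(O)\}$. (1) Let $w$ be a known measurable function of $z$, and let $\mathcal M$ be the set of laws under which the conditional covariances $\gamma,\beta$ exist almost surely (that is, given $Z$, the variables $v(X),X,Y,v(X)X,v(X)Y$ are integrable), $\beta(Z)\neq0$ and $\beta_*(Z)\le K|\beta(Z)|$ almost surely for some constant $K$, and $E|w(Z)\gamma_*(Z)/\beta(Z)|<\infty$. Let $P\in\mathcal M$, $\Lambda=E\{w(Z)\lambda(Z)\}$ and $\tilde m(x,z)=m(z)+\lambda(z)\{x-\pi(z)\}$. If $$\phi_\Lambda(y,x,z)=w(z)\,l(x|z)\{y-\tilde m(x,z)\}+w(z)\lambda(z)-\Lambda$$ has finite variance under $P$, then it is the (almost surely unique) influence function of $Q\mapsto E_Q\{w(Z)\lambda_Q(Z)\}$ at $P$ in $\mathcal M$. (2) Let $\bar{\mathcal M}$ be the set of laws under which $\gamma,\beta$ exist almost surely, $E\gamma_*(Z)<\infty$, $E\beta_*(Z)<\infty$ and $E\beta(Z)\ne0$. Let $P\in\bar{\mathcal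 M}$ with $\beta(Z)\neq0$ almost surely, $\bar\Lambda=E\{\gamma(Z)\}/E\{\beta(Z)\}$ and $w(z)=\beta(z)/E\{\beta(Z)\}$, and suppose that $$\phi_{\bar\Lambda}(y,x,z)=w(z)\,l(x|z)\bigl[y-m(z)-\bar\Lambda\{x-\pi(z)\}\bigr]$$ has finite variance under $P$. Then $E\{w(Z)\}=1$, $\bar\Lambda=E\{w(Z)\lambda(Z)\}$, and $\phi_{\bar\Lambda}$ is the (almost surely unique) influence function of $Q\mapsto E_Q\{\gamma_Q(Z)\}/E_Q\{\beta_Q(Z)\}$ at $P$ in $\bar{\mathcal M}$. (3) Let $(y_i,x_i,z_i)$, $i=1,\dots,n$, $n\ge1$, be a sample and let $\hat m,\hat\pi,\hat\rho,\hat\beta,\hat\lambda$ be fitted functions of $z$. With these in place of the true ones, the sample mean of the influence curve in (1), as a function of the unknown $\Lambda$, is zero if and only if $\Lambda$ equals $$\hat\Lambda=n^{-1}\sum_{i=1}^n\Bigl(w(z_i)\frac{v(x_i)-\hat\rho(z_i)}{\hat\beta(z_i)}\bigl[y_i-\hat m(z_i)-\hat\lambda(z_i)\{x_i-\hat\pi(z_i)\}\bigr]+w(z_i)\hat\lambda(z_i)\Bigr).$$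 If all $\hat\beta(z_i)\neq0$ and $\sum_i\{v(x_i)-\hat\rho(z_i)\}\{x_i-\hat\pi(z_i)\}\ne0$, the sample mean of the influence curve in (2), with fitted weight $\hat\beta(z)/c$ for any constant $c\neq0$, is zero if and only if $\bar\Lambda$ equals $$\hat{\bar\Lambda}=\frac{\sum_{i=1}^n\{v(x_i)-\hat\rho(z_i)\}\{y_i-\hat m(z_i)\}}{\sum_{i=1}^n\{v(x_i)-\hat\rho(z_i)\}\{x_i-\hat\pi(z_i)\}}.$$ -/

import Mathlib

open MeasureTheory ProbabilityTheory Filter Topology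

noncomputable section

namespace ContrastEffect

variable {𝒵 : Type*} [MeasurableSpace 𝒵]

/-- One observation `o = (y, x, z)`: outcome, exposure, confounders. -/
abbrev Obs (𝒵 : Type*) := ℝ × ℝ × 𝒵

/-- The marginal law of `Z` when `(Y, X, Z)` has law `Q`. -/
def lawZ (Q : ProbabilityMeasure (Obs 𝒵)) : Measure 𝒵 :=
  (Q : Measure (Obs 𝒵)).map (fun o => o.2.2)

/-- The regular conditional law of `(Y, X)` given `Z = z`. -/
def condLaw (Q : ProbabilityMeasure (Obs 𝒵)) : Kernel 𝒵 (ℝ × ℝ) :=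
  condDistrib (fun o : Obs 𝒵 => (o.1, o.2.1)) (fun o : Obs 𝒵 => o.2.2) (Q : Measure (Obs 𝒵))

/-! ### Nuisance functions -/

/-- `m(z) = E(Y | Z = z)`. -/
def outcomeMean (Q : ProbabilityMeasure (Obs 𝒵)) (z : 𝒵) : ℝ :=
  ∫ a, a.1 ∂(condLaw Q z)

/-- `π(z) = E(X | Z = z)`. -/
def exposureMean (Q : ProbabilityMeasure (Obs 𝒵)) (z : 𝒵) : ℝ :=
  ∫ a, a.2 ∂(condLaw Q z)

/-- `ρ(z) = E{v(X) | Z = z}`. -/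
def vMean (v : ℝ → ℝ) (Q : ProbabilityMeasure (Obs 𝒵)) (z : 𝒵) : ℝ :=
  ∫ a, v a.2 ∂(condLaw Q z)

/-- `Cov{v(X), Y | Z = z}`. -/
def covVY (v : ℝ → ℝ) (Q : ProbabilityMeasure (Obs 𝒵)) (z : 𝒵) : ℝ :=
  covariance (fun a : ℝ × ℝ => v a.2) (fun a => a.1) (condLaw Q z)

/-- `β(z) = Cov{v(X), X | Z = z}`. -/
def covVX (v : ℝ → ℝ) (Q : ProbabilityMeasure (Obs 𝒵)) (z : 𝒵) : ℝ :=
  covariance (fun a : ℝ × ℝ => v a.2) (fun a => a.2) (condLaw Q z)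

/-- `λ(z) = Cov{v(X), Y | Z = z} / Cov{v(X), X | Z = z}`. -/
def condEffect (v : ℝ → ℝ) (Q : ProbabilityMeasure (Obs 𝒵)) (z : 𝒵) : ℝ :=
  covVY v Q z / covVX v Q z

/-! ### Estimands -/

/-- `E{w(Z) λ(Z)}` for a known function `w`; the case `w = 1` is `Λ`. -/
def lambdaEstimand (v : ℝ → ℝ) (w : 𝒵 → ℝ) (Q : ProbabilityMeasure (Obs 𝒵)) : ℝ :=
  ∫ z, w z * condEffect v Q z ∂(lawZ Q)

/-- `Λ̄ = E[Cov{v(X), Y | Z}] / E[Cov{v(X), X | Z}]`. -/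
def lambdaBarEstimand (v : ℝ → ℝ) (Q : ProbabilityMeasure (Obs 𝒵)) : ℝ :=
  (∫ z, covVY v Q z ∂(lawZ Q)) / (∫ z, covVX v Q z ∂(lawZ Q))

/-- The normalized subgroup weight proportional to `Cov{v(X), X | Z = z}`. -/
def covWeight (v : ℝ → ℝ) (Q : ProbabilityMeasure (Obs 𝒵)) (z : 𝒵) : ℝ :=
  covVX v Q z / ∫ z', covVX v Q z' ∂(lawZ Q)

/-! ### The nonparametric models: laws at which the estimands are well defined -/

/-- The covariance of `f` and `g` under `μ` exists. -/
def CovExists (f g : ℝ × ℝ → ℝ) (μ : Measure (ℝ × ℝ)) : Prop :=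
  Integrable f μ ∧ Integrable g μ ∧ Integrable (fun a => f a * g a) μ

/-- `E |f(A) - f(A')| |g(A) - g(A')|` for independent copies `A`, `A'` with law `μ`. Without the
absolute values this is twice the covariance of `f(A)` and `g(A)`. -/
def absCov (f g : ℝ × ℝ → ℝ) (μ : Measure (ℝ × ℝ)) : ℝ :=
  ∫ p, |f p.1 - f p.2| * |g p.1 - g p.2| ∂(μ.prod μ)

/-- `absCov` of `v(X)` and `Y` given `Z = z`. -/
def absCovVY (v : ℝ → ℝ) (Q : ProbabilityMeasure (Obs 𝒵)) (z : 𝒵) : ℝ :=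
  absCov (fun a => v a.2) (fun a => a.1) (condLaw Q z)

/-- `absCov` of `v(X)` and `X` given `Z = z`; it equals `2 |Cov{v(X), X | Z = z}|` if `v` is
monotone (increasing or decreasing) on the support of `X`. -/
def absCovVX (v : ℝ → ℝ) (Q : ProbabilityMeasure (Obs 𝒵)) (z : 𝒵) : ℝ :=
  absCov (fun a => v a.2) (fun a => a.2) (condLaw Q z)

/-- The conditional covariances of `v(X)` with `Y` and with `X` given `Z` exist. -/
def CondCovExist (v : ℝ → ℝ) (Q : ProbabilityMeasure (Obs 𝒵)) : Prop :=
  ∀ᵐ z ∂(lawZ Q),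
    CovExists (fun a => v a.2) (fun a => a.1) (condLaw Q z) ∧
    CovExists (fun a => v a.2) (fun a => a.2) (condLaw Q z)

/-- The nonparametric model for `E{w(Z) λ(Z)}`: the conditional covariances exist, the denominator
`Cov{v(X), X | Z}` does not vanish and, relative to the spread of `v(X)` and `X`, is bounded away
from zero (for monotone `v` this last clause holds with `K = 2`), and the integrand is integrable
together with its absolute version. -/
def lambdaModel (v : ℝ → ℝ) (w : 𝒵 → ℝ) : Set (ProbabilityMeasure (Obs 𝒵)) :=
  {Q | CondCovExist v Q ∧
    (∀ᵐ z ∂(lawZ Q), covVX v Q z ≠ 0) ∧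
    (∃ K : ℝ, ∀ᵐ z ∂(lawZ Q), absCovVX v Q z ≤ K * |covVX v Q z|) ∧
    Integrable (fun z => w z * absCovVY v Q z / covVX v Q z) (lawZ Q)}

/-- The nonparametric model for `Λ̄`: the conditional covariances exist, are integrable together
with their absolute versions, and the denominator of `Λ̄` does not vanish. -/
def lambdaBarModel (v : ℝ → ℝ) : Set (ProbabilityMeasure (Obs 𝒵)) :=
  {Q | CondCovExist v Q ∧
    Integrable (absCovVY v Q) (lawZ Q) ∧
    Integrable (absCovVX v Q) (lawZ Q) ∧
    ∫ z, covVX v Q z ∂(lawZ Q) ≠ 0}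

/-! ### Influence functions -/

/-- `t ↦ Q t` is a one-dimensional submodel through `P` with bounded score `s`: near `t = 0`, `Q t`
has a density with respect to `P`, and this density is `1 + t s + o(t)` uniformly. For every
bounded `s` with mean zero under `P` the densities `1 + t s` give such a submodel, so the scores are
dense in the mean-zero square-integrable functions: the model is nonparametric. -/
def IsSubmodel {𝒪 : Type*} [MeasurableSpace 𝒪] (P : ProbabilityMeasure 𝒪) (s : 𝒪 → ℝ)
    (Q : ℝ → ProbabilityMeasure 𝒪) : Prop :=
  Measurable s ∧ (∃ B : ℝ, ∀ o, |s o| ≤ B) ∧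
  ∃ p : ℝ → 𝒪 → ℝ, (∀ t, Measurable (p t)) ∧ (∀ t o, 0 ≤ p t o) ∧
    (∀ᶠ t in 𝓝 (0 : ℝ),
      (Q t : Measure 𝒪) = (P : Measure 𝒪).withDensity (fun o => ENNReal.ofReal (p t o))) ∧
    (∀ ε > 0, ∀ᶠ t in 𝓝 (0 : ℝ), ∀ᵐ o ∂(P : Measure 𝒪), |p t o - 1 - t * s o| ≤ ε * |t|)

/-- `φ` is an influence function of `Ψ` at `P` in the nonparametric model `M`: it has mean zero and
finite variance, and along every submodel with score `s` the law stays in `M` near `t = 0` and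
`Ψ` has derivative `E{φ(O) s(O)}` at `t = 0`. -/
def IsInfluenceFunction {𝒪 : Type*} [MeasurableSpace 𝒪] (M : Set (ProbabilityMeasure 𝒪))
    (Ψ : ProbabilityMeasure 𝒪 → ℝ) (P : ProbabilityMeasure 𝒪) (φ : 𝒪 → ℝ) : Prop :=
  MemLp φ 2 (P : Measure 𝒪) ∧ ∫ o, φ o ∂(P : Measure 𝒪) = 0 ∧
  ∀ (s : 𝒪 → ℝ) (Q : ℝ → ProbabilityMeasure 𝒪), IsSubmodel P s Q →
    (∀ᶠ t in 𝓝 (0 : ℝ), Q t ∈ M) ∧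
    HasDerivAt (fun t => Ψ (Q t)) (∫ o, φ o * s o ∂(P : Measure 𝒪)) 0

/-- `φ` is, up to almost sure equality, the only influence function of `Ψ` at `P`. -/
def IsTheInfluenceFunction {𝒪 : Type*} [MeasurableSpace 𝒪] (M : Set (ProbabilityMeasure 𝒪))
    (Ψ : ProbabilityMeasure 𝒪 → ℝ) (P : ProbabilityMeasure 𝒪) (φ : 𝒪 → ℝ) : Prop :=
  IsInfluenceFunction M Ψ P φ ∧
  ∀ φ' : 𝒪 → ℝ, IsInfluenceFunction M Ψ P φ' → φ' =ᵐ[(P : Measure 𝒪)] φ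

/-! ### The influence curves, for arbitrary values of the nuisance functions -/

/-- The contrast function `l(x|z) = {v(x) - ρ(z)} / β(z)`. -/
def contrast (v : ℝ → ℝ) (ρ β : 𝒵 → ℝ) (x : ℝ) (z : 𝒵) : ℝ := (v x - ρ z) / β z

/-- `w(z) l(x|z) {y - m̃(x,z)} + w(z) λ(z) - θ` with `m̃(x,z) = m(z) + λ(z) {x - π(z)}`. -/
def icLambda (v : ℝ → ℝ) (w ρ β m π lam : 𝒵 → ℝ) (θ : ℝ) (o : Obs 𝒵) : ℝ :=
  w o.2.2 * contrast v ρ β o.2.1 o.2.2 * (o.1 - (m o.2.2 + lam o.2.2 * (o.2.1 - π o.2.2)))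
    + w o.2.2 * lam o.2.2 - θ

/-- `w(z) l(x|z) {y - m̄(x,z)}` with `m̄(x,z) = m(z) + θ {x - π(z)}`. -/
def icLambdaBar (v : ℝ → ℝ) (w ρ β m π : 𝒵 → ℝ) (θ : ℝ) (o : Obs 𝒵) : ℝ :=
  w o.2.2 * contrast v ρ β o.2.1 o.2.2 * (o.1 - (m o.2.2 + θ * (o.2.1 - π o.2.2)))

/-- The influence curve of `E{w(Z) λ(Z)}` at the law `P`. -/
def phiLambda (v : ℝ → ℝ) (w : 𝒵 → ℝ) (P : ProbabilityMeasure (Obs 𝒵)) : Obs 𝒵 → ℝ :=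
  icLambda v w (vMean v P) (covVX v P) (outcomeMean P) (exposureMean P) (condEffect v P)
    (lambdaEstimand v w P)

/-- The influence curve of `Λ̄` at the law `P`. -/
def phiLambdaBar (v : ℝ → ℝ) (P : ProbabilityMeasure (Obs 𝒵)) : Obs 𝒵 → ℝ :=
  icLambdaBar v (covWeight v P) (vMean v P) (covVX v P) (outcomeMean P) (exposureMean P)
    (lambdaBarEstimand v P)

/-! ### The estimators, from a sample and fitted nuisance functions -/

/-- The estimator of `E{w(Z) λ(Z)}`; the case `w = 1` estimates `Λ`. -/
def lambdaHat (v : ℝ → ℝ) (w ρ β m π lam : 𝒵 → ℝ) {n : ℕ} (o : Fin n → Obs 𝒵) : ℝ :=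
  (n : ℝ)⁻¹ * ∑ i, (w (o i).2.2 * ((v (o i).2.1 - ρ (o i).2.2) / β (o i).2.2) *
      ((o i).1 - m (o i).2.2 - lam (o i).2.2 * ((o i).2.1 - π (o i).2.2))
    + w (o i).2.2 * lam (o i).2.2)

/-- The estimator of `Λ̄`. -/
def lambdaBarHat (v : ℝ → ℝ) (ρ m π : 𝒵 → ℝ) {n : ℕ} (o : Fin n → Obs 𝒵) : ℝ :=
  (∑ i, (v (o i).2.1 - ρ (o i).2.2) * ((o i).1 - m (o i).2.2)) /
    ∑ i, (v (o i).2.1 - ρ (o i).2.2) * ((o i).2.1 - π (o i).2.2)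

end ContrastEffect

end

/-!
Along a submodel, the law of `Z` gets the density `r t z = E{p t | Z = z}`, and the law of `(Y, X)`
given `Z = z` is tilted by `p t / r t z`. Twice a covariance is the mean of
`{f(A) - f(A')} {g(A) - g(A')}` over independent copies `A`, `A'`, so `r t z` times twice a
conditional covariance is the mean of that kernel weighted by `p t (A) * p t (A') / r t z`. The
uniform expansion `p t = 1 + t s + o(t)` thus passes to this product with an error relative to the
mean of the absolute value of the kernel, and its derivative is the conditional mean of `s` times
the product of the centered variables. The models make these error bounds integrable, and keep
quotients of covariances under control, so that one may differentiate under the integral over `Z`;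
the derivative is recognized as `E{φ(O) s(O)}` by conditioning on `Z`.

For uniqueness, every event `A` gives the submodel with densities `1 + t {1_A - P(A)}`, hence the
integral of an influence function over `A` is determined by the functional.
-/

namespace ContrastEffect

open Asymptotics

section Curry

variable {β γ : Type*}

theorem tendsto_snd_curry (l : Filter β) (m : Filter γ) : Tendsto Prod.snd (l.curry m) m :=
  tendsto_snd.mono_left curry_le_prod

theorem isBigO_comp_snd {E F : Type*} [Norm E] [Norm F] {f : γ → E} {g : γ → F} {m : Filter γ}
    (h : f =O[m] g) (l : Filter β) : (fun q : β × γ => f q.2) =O[l.curry m] fun q => g q.2 :=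
  h.comp_tendsto (tendsto_snd_curry l m)

theorem fst_isLittleO_one (m : Filter γ) :
    (fun q : ℝ × γ => q.1) =o[(𝓝 0).curry m] fun _ => (1 : ℝ) :=
  (isLittleO_one_iff ℝ).2 (tendsto_fst.mono_left curry_le_prod)

end Curry

section UniformDeriv

variable {α : Type*} [MeasurableSpace α] {μ : Measure α}

/-- `F t x = f x + t f' x + o(t G x)` as `t → 0`, uniformly in `μ`-almost every `x`, where the
weight `G` also dominates `f` and `f'`. The curried filter expresses the uniformity: the exceptional
null set may depend on `t`. -/
structure HasUniformDeriv (μ : Measure α) (F : ℝ → α → ℝ) (f f' G : α → ℝ) : Prop where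
  isBigO : f =O[ae μ] G
  isBigO_deriv : f' =O[ae μ] G
  isLittleO : (fun q : ℝ × α => F q.1 q.2 - f q.2 - q.1 * f' q.2)
    =o[(𝓝 0).curry (ae μ)] fun q => q.1 * G q.2

namespace HasUniformDeriv

variable {F H : ℝ → α → ℝ} {f f' G h h' K : α → ℝ}

theorem fst_mul_deriv_isLittleO (hF : HasUniformDeriv μ F f f' G) :
    (fun q : ℝ × α => q.1 * f' q.2) =o[(𝓝 0).curry (ae μ)] fun q => G q.2 := by
  simpa only [one_mul] using (fst_isLittleO_one (ae μ)).mul_isBigO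
    (isBigO_comp_snd hF.isBigO_deriv (𝓝 0))

theorem sub_isLittleO (hF : HasUniformDeriv μ F f f' G) :
    (fun q : ℝ × α => F q.1 q.2 - f q.2) =o[(𝓝 0).curry (ae μ)] fun q => G q.2 := by
  have remainder : (fun q : ℝ × α => q.1 * G q.2) =O[(𝓝 0).curry (ae μ)] fun q => G q.2 := by
    simpa only [one_mul] using (fst_isLittleO_one (ae μ)).isBigO.mul (isBigO_refl _ _)
  exact ((hF.isLittleO.trans_isBigO remainder).add hF.fst_mul_deriv_isLittleO).congr_left
    fun q => by ring

theorem apply_isBigO (hF : HasUniformDeriv μ F f f' G) :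
    (fun q : ℝ × α => F q.1 q.2) =O[(𝓝 0).curry (ae μ)] fun q => G q.2 :=
  (hF.sub_isLittleO.isBigO.add (isBigO_comp_snd hF.isBigO (𝓝 0))).congr_left fun q => by simp

theorem eventually_isBigO (hF : HasUniformDeriv μ F f f' G) :
    ∀ᶠ t in 𝓝 0, F t =O[ae μ] G := by
  obtain ⟨c, hc⟩ := hF.apply_isBigO.bound
  filter_upwards [eventually_curry_iff.1 hc] with t ht using IsBigO.of_bound c ht

theorem apply_zero_ae_eq (hF : HasUniformDeriv μ F f f' G) : F 0 =ᵐ[μ] f := by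
  filter_upwards [(eventually_curry_iff.1 (hF.isLittleO.def one_pos)).self_of_nhds] with x hx
  simpa [sub_eq_zero] using hx

theorem congr (hF : HasUniformDeriv μ F f f' G) (hFH : ∀ᶠ t in 𝓝 0, F t =ᵐ[μ] H t)
    (hf : f =ᵐ[μ] h) (hf' : f' =ᵐ[μ] h') : HasUniformDeriv μ H h h' G where
  isBigO := hF.isBigO.congr' hf .rfl
  isBigO_deriv := hF.isBigO_deriv.congr' hf' .rfl
  isLittleO := by
    refine hF.isLittleO.congr' (eventually_curry_iff.2 ?_) .rfl
    filter_upwards [hFH] with t ht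
    filter_upwards [ht, hf, hf'] with x h₁ h₂ h₃
    rw [h₁, h₂, h₃]

theorem mono_weight (hF : HasUniformDeriv μ F f f' G) (hG : G =O[ae μ] K) :
    HasUniformDeriv μ F f f' K where
  isBigO := hF.isBigO.trans hG
  isBigO_deriv := hF.isBigO_deriv.trans hG
  isLittleO := hF.isLittleO.trans_isBigO <|
    (isBigO_refl _ _).mul (isBigO_comp_snd hG (𝓝 0))

theorem const (f : α → ℝ) : HasUniformDeriv μ (fun _ => f) f 0 f where
  isBigO := isBigO_refl _ _
  isBigO_deriv := isBigO_zero _ _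
  isLittleO := by simp

theorem comp {β : Type*} [MeasurableSpace β] {ν : Measure β} {g : β → α}
    (hF : HasUniformDeriv μ F f f' G) (hg : Measure.QuasiMeasurePreserving g ν μ) :
    HasUniformDeriv ν (fun t => F t ∘ g) (f ∘ g) (f' ∘ g) (G ∘ g) where
  isBigO := hF.isBigO.comp_tendsto hg.tendsto_ae
  isBigO_deriv := hF.isBigO_deriv.comp_tendsto hg.tendsto_ae
  isLittleO := by
    have map_curry : Tendsto (Prod.map id g) ((𝓝 (0 : ℝ)).curry (ae ν))
        ((𝓝 0).curry (ae μ)) := fun s hs => by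
      have hs : ∀ᶠ t in 𝓝 0, ∀ᵐ x ∂μ, (t, x) ∈ s := hs
      exact hs.mono fun t ht => hg.tendsto_ae.eventually ht
    exact hF.isLittleO.comp_tendsto map_curry

theorem mul (hF : HasUniformDeriv μ F f f' G) (hH : HasUniformDeriv μ H h h' K) :
    HasUniformDeriv μ (fun t x => F t x * H t x) (fun x => f x * h x)
      (fun x => f' x * h x + f x * h' x) (fun x => G x * K x) where
  isBigO := hF.isBigO.mul hH.isBigO
  isBigO_deriv := (hF.isBigO_deriv.mul hH.isBigO).add (hF.isBigO.mul hH.isBigO_deriv)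
  isLittleO := by
    have left := hF.isLittleO.mul_isBigO hH.apply_isBigO
    have right := ((isBigO_comp_snd hF.isBigO (𝓝 0)).add
      hF.fst_mul_deriv_isLittleO.isBigO).mul_isLittleO hH.isLittleO
    have second_order := hF.fst_mul_deriv_isLittleO.mul_isBigO <|
      (isBigO_refl (fun q : ℝ × α => q.1) _).mul (isBigO_comp_snd hH.isBigO_deriv (𝓝 0))
    refine (((left.congr_right fun q => ?_).add (right.congr_right fun q => ?_)).add
      (second_order.congr_right fun q => ?_)).congr_left fun q => ?_
    all_goals ring

-- The value itself as weight makes the relative error small, as inversion requires.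

theorem isTheta (hF : HasUniformDeriv μ F f f' f) :
    (fun q : ℝ × α => F q.1 q.2) =Θ[(𝓝 0).curry (ae μ)] fun q => f q.2 :=
  IsEquivalent.isTheta hF.sub_isLittleO

theorem eventually_ne_zero (hF : HasUniformDeriv μ F f f' f) (hf : ∀ᵐ x ∂μ, f x ≠ 0) :
    ∀ᶠ t in 𝓝 0, ∀ᵐ x ∂μ, F t x ≠ 0 := by
  filter_upwards [eventually_curry_iff.1 hF.isTheta.eq_zero_iff] with t ht
  filter_upwards [ht, hf] with x hx hfx using hx.not.2 hfx

theorem eventually_weight_isBigO (hF : HasUniformDeriv μ F f f' f) :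
    ∀ᶠ t in 𝓝 0, f =O[ae μ] F t := by
  obtain ⟨c, hc⟩ := hF.isTheta.2.bound
  filter_upwards [eventually_curry_iff.1 hc] with t ht using IsBigO.of_bound c ht

theorem inv (hF : HasUniformDeriv μ F f f' f) (hf : ∀ᵐ x ∂μ, f x ≠ 0) :
    HasUniformDeriv μ (fun t x => (F t x)⁻¹) (fun x => (f x)⁻¹) (fun x => -f' x * (f x)⁻¹ ^ 2)
      (fun x => (f x)⁻¹) where
  isBigO := isBigO_refl _ _
  isBigO_deriv := by
    refine (hF.isBigO_deriv.neg_left.mul (isBigO_refl (fun x => (f x)⁻¹ ^ 2) _)).congr' .rfl ?_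
    filter_upwards [hf] with x hx
    field_simp
  isLittleO := by
    have inv_isBigO := hF.isTheta.inv.1
    have value := hF.isLittleO.neg_left.mul_isBigO
      ((isBigO_refl (fun q : ℝ × α => (f q.2)⁻¹) _).mul inv_isBigO)
    have deriv := (((isBigO_refl (fun q : ℝ × α => q.1) _).mul
      (isBigO_comp_snd hF.isBigO_deriv (𝓝 0))).mul_isLittleO hF.sub_isLittleO).mul_isBigO
      ((isBigO_refl (fun q : ℝ × α => (f q.2)⁻¹ ^ 2) _).mul inv_isBigO)
    have ne_zero : ∀ᶠ q : ℝ × α in (𝓝 0).curry (ae μ), f q.2 ≠ 0 ∧ F q.1 q.2 ≠ 0 := by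
      filter_upwards [hF.isTheta.eq_zero_iff, (tendsto_snd_curry (𝓝 0) (ae μ)).eventually hf]
        with q hq hfq
      exact ⟨hfq, hq.not.2 hfq⟩
    refine ((value.congr' .rfl ?_).add (deriv.congr' .rfl ?_)).congr' ?_ .rfl
    all_goals
      filter_upwards [ne_zero] with q hq
      obtain ⟨hfq, hFq⟩ := hq
      field_simp
    ring

end HasUniformDeriv

end UniformDeriv

section Integral

variable {α β : Type*} [MeasurableSpace α] [MeasurableSpace β] {μ : Measure α}

theorem integrable_of_isBigO_ae {f G : α → ℝ} (hG : Integrable G μ)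
    (hf : AEStronglyMeasurable f μ) (h : f =O[ae μ] G) : Integrable f μ := by
  obtain ⟨c, hc⟩ := h.bound
  exact (hG.norm.const_mul c).mono' hf hc

theorem isBigO_integral_kernel [SFinite μ] {κ : Kernel α β} [IsSFiniteKernel κ] {f G : α × β → ℝ}
    (h : f =O[ae (μ ⊗ₘ κ)] G) (hG : ∀ᵐ x ∂μ, Integrable (fun y => G (x, y)) (κ x)) :
    (fun x => ∫ y, f (x, y) ∂κ x) =O[ae μ] fun x => ∫ y, |G (x, y)| ∂κ x := by
  obtain ⟨c, hc⟩ := h.bound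
  refine IsBigO.of_bound c ?_
  filter_upwards [Measure.ae_ae_of_ae_compProd hc, hG] with x hx hGx
  calc ‖∫ y, f (x, y) ∂κ x‖ ≤ ∫ y, c * |G (x, y)| ∂κ x :=
        norm_integral_le_of_norm_le (hGx.abs.const_mul c) hx
    _ = c * ‖∫ y, |G (x, y)| ∂κ x‖ := by
        rw [integral_const_mul, Real.norm_of_nonneg (integral_nonneg fun y => abs_nonneg _)]

theorem norm_integral_sub_sub_le {F f f' G : α → ℝ} {t c : ℝ} (hF : Integrable F μ)
    (hf : Integrable f μ) (hf' : Integrable f' μ) (hG : Integrable G μ)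
    (h : ∀ᵐ x ∂μ, ‖F x - f x - t * f' x‖ ≤ c * ‖t * G x‖) :
    ‖(∫ x, F x ∂μ) - (∫ x, f x ∂μ) - t * ∫ x, f' x ∂μ‖ ≤ c * ‖t * ∫ x, |G x| ∂μ‖ := by
  rw [← integral_const_mul, ← integral_sub hF hf,
    ← integral_sub (f := fun x => F x - f x) (hF.sub hf) (hf'.const_mul t), norm_mul,
    Real.norm_of_nonneg (integral_nonneg fun x => abs_nonneg (G x)), ← mul_assoc,
    ← integral_const_mul]
  refine norm_integral_le_of_norm_le (hG.abs.const_mul _) ?_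
  filter_upwards [h] with x hx
  rwa [norm_mul, ← mul_assoc] at hx

namespace HasUniformDeriv

theorem hasDerivAt_integral {F : ℝ → α → ℝ} {f f' G : α → ℝ} (h : HasUniformDeriv μ F f f' G)
    (hF : ∀ᶠ t in 𝓝 0, AEStronglyMeasurable (F t) μ) (hf : AEStronglyMeasurable f μ)
    (hf' : AEStronglyMeasurable f' μ) (hG : Integrable G μ) :
    HasDerivAt (fun t => ∫ x, F t x ∂μ) (∫ x, f' x ∂μ) 0 := by
  have f_int := integrable_of_isBigO_ae hG hf h.isBigO
  have f'_int := integrable_of_isBigO_ae hG hf' h.isBigO_deriv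
  have expansion : (fun t => (∫ x, F t x ∂μ) - (∫ x, f x ∂μ) - t * ∫ x, f' x ∂μ)
      =o[𝓝 0] fun t => t * ∫ x, |G x| ∂μ := by
    refine isLittleO_iff.2 fun c hc => ?_
    filter_upwards [eventually_curry_iff.1 (h.isLittleO.def hc), h.eventually_isBigO, hF]
      with t remainder Ft_isBigO Ft_meas
    exact norm_integral_sub_sub_le (integrable_of_isBigO_ae hG Ft_meas Ft_isBigO) f_int f'_int hG
      remainder
  rw [hasDerivAt_iff_isLittleO, integral_congr_ae h.apply_zero_ae_eq]
  simpa only [sub_zero, smul_eq_mul, mul_one] using expansion.trans_isBigO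
    ((isBigO_refl (fun t : ℝ => t) _).mul (isBigO_const_const _ (one_ne_zero' ℝ) _))

theorem integral_kernel [SFinite μ] {κ : Kernel α β} [IsSFiniteKernel κ] {F : ℝ → α × β → ℝ}
    {f f' G : α × β → ℝ} (h : HasUniformDeriv (μ ⊗ₘ κ) F f f' G)
    (hF : ∀ᶠ t in 𝓝 0, Measurable (F t)) (hf : Measurable f) (hf' : Measurable f')
    (hG : ∀ᵐ x ∂μ, Integrable (fun y => G (x, y)) (κ x)) :
    HasUniformDeriv μ (fun t x => ∫ y, F t (x, y) ∂κ x) (fun x => ∫ y, f (x, y) ∂κ x)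
      (fun x => ∫ y, f' (x, y) ∂κ x) fun x => ∫ y, |G (x, y)| ∂κ x where
  isBigO := isBigO_integral_kernel h.isBigO hG
  isBigO_deriv := isBigO_integral_kernel h.isBigO_deriv hG
  isLittleO := by
    have slice_integrable {k : α × β → ℝ} (hk : Measurable k) (hkG : k =O[ae (μ ⊗ₘ κ)] G) :
        ∀ᵐ x ∂μ, Integrable (fun y => k (x, y)) (κ x) := by
      obtain ⟨c, hc⟩ := hkG.bound
      filter_upwards [Measure.ae_ae_of_ae_compProd hc, hG] with x hx hGx
      exact integrable_of_isBigO_ae hGx (hk.comp measurable_prodMk_left).aestronglyMeasurable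
        (.of_bound c hx)
    refine isLittleO_iff.2 fun c hc => eventually_curry_iff.2 ?_
    filter_upwards [eventually_curry_iff.1 (h.isLittleO.def hc), h.eventually_isBigO, hF]
      with t remainder Ft_isBigO Ft_meas
    filter_upwards [Measure.ae_ae_of_ae_compProd remainder, slice_integrable Ft_meas Ft_isBigO,
      slice_integrable hf h.isBigO, slice_integrable hf' h.isBigO_deriv, hG]
      with x remainder_x F_int f_int f'_int G_int
    exact norm_integral_sub_sub_le F_int f_int f'_int G_int remainder_x

end HasUniformDeriv

end Integral

section Tilt

variable {α β : Type*} [MeasurableSpace α] [MeasurableSpace β] {μ : Measure α} {κ : Kernel α β}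
  {p : α × β → ℝ}

/-- The conditional mean `E{p(x, B) | x}` of a density `p` when `B` has conditional law `κ x`: the
density of the tilted marginal law. -/
noncomputable def condMass (κ : Kernel α β) (p : α × β → ℝ) (x : α) : ℝ := ∫ y, p (x, y) ∂κ x

/-- The conditional law `κ` reweighted by the density `p` and normalized. Where the normalizing
constant vanishes, division by zero makes it the zero measure. -/
noncomputable def condTilt (κ : Kernel α β) [IsSFiniteKernel κ] (p : α × β → ℝ) : Kernel α β :=
  κ.withDensity fun x y => ENNReal.ofReal (p (x, y) / condMass κ p x)

theorem measurable_condMass [IsSFiniteKernel κ] (hp : Measurable p) :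
    Measurable (condMass κ p) :=
  (hp.stronglyMeasurable.integral_kernel_prod_right' (κ := κ)).measurable

theorem condMass_nonneg (hp_nonneg : 0 ≤ p) (x : α) : 0 ≤ condMass κ p x :=
  integral_nonneg fun y => hp_nonneg (x, y)

theorem measurable_condTilt_density [IsSFiniteKernel κ] (hp : Measurable p) :
    Measurable (Function.uncurry fun x y => ENNReal.ofReal (p (x, y) / condMass κ p x)) :=
  (hp.div ((measurable_condMass hp).comp measurable_fst)).ennreal_ofReal

theorem condTilt_apply [IsSFiniteKernel κ] (hp : Measurable p) (x : α) :
    condTilt κ p x = (κ x).withDensity fun y => ENNReal.ofReal (p (x, y) / condMass κ p x) :=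
  Kernel.withDensity_apply κ (measurable_condTilt_density hp) x

theorem lintegral_ofReal_eq_condMass (hp_nonneg : 0 ≤ p) {x : α}
    (hint : Integrable (fun y => p (x, y)) (κ x)) :
    ∫⁻ y, ENNReal.ofReal (p (x, y)) ∂κ x = ENNReal.ofReal (condMass κ p x) :=
  (ofReal_integral_eq_lintegral_ofReal hint (.of_forall fun y => hp_nonneg (x, y))).symm

theorem isProbabilityMeasure_condTilt_apply [IsSFiniteKernel κ] (hp : Measurable p)
    (hp_nonneg : 0 ≤ p) {x : α} (hmass : condMass κ p x ≠ 0) :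
    IsProbabilityMeasure (condTilt κ p x) := by
  have hint : Integrable (fun y => p (x, y)) (κ x) := .of_integral_ne_zero hmass
  constructor
  rw [condTilt_apply hp, withDensity_apply _ .univ, Measure.restrict_univ,
    ← ofReal_integral_eq_lintegral_ofReal (hint.div_const _)
      (.of_forall fun y => div_nonneg (hp_nonneg _) (condMass_nonneg hp_nonneg x)),
    integral_div, ← condMass, div_self hmass, ENNReal.ofReal_one]

theorem isFiniteKernel_condTilt [IsSFiniteKernel κ] (hp : Measurable p) (hp_nonneg : 0 ≤ p) :
    IsFiniteKernel (condTilt κ p) := by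
  refine ⟨1, ENNReal.one_lt_top, fun x => ?_⟩
  by_cases hmass : condMass κ p x = 0
  · simp [condTilt_apply hp, hmass]
  · have := isProbabilityMeasure_condTilt_apply hp hp_nonneg hmass
    exact prob_le_one

theorem fst_withDensity_compProd [SFinite μ] [IsSFiniteKernel κ] (hp : Measurable p)
    (hp_nonneg : 0 ≤ p) (hint : ∀ᵐ x ∂μ, Integrable (fun y => p (x, y)) (κ x)) :
    ((μ ⊗ₘ κ).withDensity fun q => ENNReal.ofReal (p q)).fst =
      μ.withDensity fun x => ENNReal.ofReal (condMass κ p x) := by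
  ext s hs
  rw [Measure.fst_apply hs, withDensity_apply _ (measurable_fst hs), withDensity_apply _ hs,
    ← Set.prod_univ, Measure.setLIntegral_compProd hp.ennreal_ofReal hs .univ]
  refine setLIntegral_congr_fun_ae hs ?_
  filter_upwards [hint] with x hx _
  rw [Measure.restrict_univ, lintegral_ofReal_eq_condMass hp_nonneg hx]

theorem condMass_mul_ofReal_div_condMass (hp_nonneg : 0 ≤ p) {x : α}
    (hint : Integrable (fun y => p (x, y)) (κ x)) :
    ∀ᵐ y ∂κ x, ENNReal.ofReal (condMass κ p x) * ENNReal.ofReal (p (x, y) / condMass κ p x) =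
      ENNReal.ofReal (p (x, y)) := by
  by_cases hmass : condMass κ p x = 0
  · have hp_zero := (integral_eq_zero_iff_of_nonneg (fun y => hp_nonneg (x, y)) hint).1 hmass
    filter_upwards [hp_zero] with y hy
    simp [hy]
  · refine .of_forall fun y => ?_
    rw [← ENNReal.ofReal_mul (condMass_nonneg hp_nonneg x), mul_div_cancel₀ _ hmass]

theorem withDensity_compProd [SFinite μ] [IsSFiniteKernel κ] (hp : Measurable p)
    (hp_nonneg : 0 ≤ p) (hint : ∀ᵐ x ∂μ, Integrable (fun y => p (x, y)) (κ x)) :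
    (μ ⊗ₘ κ).withDensity (fun q => ENNReal.ofReal (p q)) =
      (μ.withDensity fun x => ENNReal.ofReal (condMass κ p x)) ⊗ₘ condTilt κ p := by
  have := isFiniteKernel_condTilt (κ := κ) hp hp_nonneg
  have mass_meas : Measurable fun x => ENNReal.ofReal (condMass κ p x) :=
    (measurable_condMass hp).ennreal_ofReal
  have density_meas (x : α) :
      Measurable fun y => ENNReal.ofReal (p (x, y) / condMass κ p x) :=
    (measurable_condTilt_density hp).comp measurable_prodMk_left
  refine Measure.ext_of_lintegral _ fun g hg => ?_
  have slice_meas (x : α) : Measurable fun y => g (x, y) := hg.comp measurable_prodMk_left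
  rw [lintegral_withDensity_eq_lintegral_mul _ hp.ennreal_ofReal hg,
    Measure.lintegral_compProd (hp.ennreal_ofReal.mul hg), Measure.lintegral_compProd hg,
    lintegral_withDensity_eq_lintegral_mul _ mass_meas hg.lintegral_kernel_prod_right']
  refine lintegral_congr_ae ?_
  filter_upwards [hint] with x hx
  rw [Pi.mul_apply, condTilt_apply hp,
    lintegral_withDensity_eq_lintegral_mul _ (density_meas x) (slice_meas x),
    ← lintegral_const_mul _ ((density_meas x).mul (slice_meas x))]
  refine lintegral_congr_ae ?_
  filter_upwards [condMass_mul_ofReal_div_condMass hp_nonneg hx] with y hy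
  rw [Pi.mul_apply, Pi.mul_apply, ← mul_assoc, hy]

theorem condMass_mul_integral_condTilt_prod [IsSFiniteKernel κ] (hp : Measurable p)
    (hp_nonneg : 0 ≤ p) (K : β × β → ℝ) (x : α) :
    condMass κ p x * ∫ b, K b ∂(condTilt κ p x).prod (condTilt κ p x) =
      (∫ b, p (x, b.1) * p (x, b.2) * K b ∂(κ x).prod (κ x)) * (condMass κ p x)⁻¹ := by
  have density_meas : Measurable fun y => ENNReal.ofReal (p (x, y) / condMass κ p x) :=
    (measurable_condTilt_density hp).comp measurable_prodMk_left
  have density_nonneg (y : β) : 0 ≤ p (x, y) / condMass κ p x :=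
    div_nonneg (hp_nonneg _) (condMass_nonneg hp_nonneg x)
  rw [condTilt_apply hp, prod_withDensity density_meas density_meas,
    integral_withDensity_eq_integral_toReal_smul (by fun_prop)
      (.of_forall fun b => ENNReal.mul_lt_top ENNReal.ofReal_lt_top ENNReal.ofReal_lt_top),
    ← integral_const_mul, ← integral_mul_const]
  refine integral_congr_ae (.of_forall fun b => ?_)
  simp only [ENNReal.toReal_mul, ENNReal.toReal_ofReal (density_nonneg _), smul_eq_mul]
  by_cases hmass : condMass κ p x = 0
  · simp [hmass]
  · field_simp

end Tilt

section Pairs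

variable {α β : Type*} [MeasurableSpace α] [MeasurableSpace β] {μ : Measure α} [SFinite μ]
  {κ : Kernel α β} [IsMarkovKernel κ]

theorem quasiMeasurePreserving_map_id_compProd {γ : Type*} [MeasurableSpace γ] {κ : Kernel α β}
    {η : Kernel α γ} [IsSFiniteKernel κ] {g : β → γ} (hg : Measurable g) (hκη : κ.map g = η) :
    Measure.QuasiMeasurePreserving (Prod.map id g) (μ ⊗ₘ κ) (μ ⊗ₘ η) := by
  subst hκη
  exact ⟨measurable_id.prodMap hg, (Measure.compProd_map hg).symm.le.absolutelyContinuous⟩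

theorem HasUniformDeriv.mul_pair {p : ℝ → α × β → ℝ} {s : α × β → ℝ}
    (h : HasUniformDeriv (μ ⊗ₘ κ) p (fun _ => 1) s fun _ => 1) :
    HasUniformDeriv (μ ⊗ₘ (κ ×ₖ κ)) (fun t q => p t (q.1, q.2.1) * p t (q.1, q.2.2))
      (fun _ => 1) (fun q => s (q.1, q.2.1) + s (q.1, q.2.2)) fun _ => 1 := by
  have fst := h.comp (quasiMeasurePreserving_map_id_compProd (μ := μ) measurable_fst
    ((Kernel.fst_eq _).symm.trans (Kernel.fst_prod κ κ)))
  have snd := h.comp (quasiMeasurePreserving_map_id_compProd (μ := μ) measurable_snd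
    ((Kernel.snd_eq _).symm.trans (Kernel.snd_prod κ κ)))
  simpa [Function.comp_def, Prod.map] using fst.mul snd

protected theorem HasUniformDeriv.condMass {p : ℝ → α × β → ℝ} {s : α × β → ℝ}
    (h : HasUniformDeriv (μ ⊗ₘ κ) p (fun _ => 1) s fun _ => 1) (hp : ∀ t, Measurable (p t))
    (hs : Measurable s) :
    HasUniformDeriv μ (fun t => condMass κ (p t)) (fun _ => 1) (condMass κ s) fun _ => 1 := by
  have mass := h.integral_kernel (.of_forall hp) measurable_const hs
    (.of_forall fun x => integrable_const 1)
  simp only [integral_const, probReal_univ, smul_eq_mul, mul_one, abs_one] at mass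
  exact mass

protected theorem HasUniformDeriv.condMass_mul_integral_condTilt_prod
    {p : ℝ → α × β → ℝ} {s : α × β → ℝ}
    (h : HasUniformDeriv (μ ⊗ₘ κ) p (fun _ => 1) s fun _ => 1) (hp : ∀ t, Measurable (p t))
    (hp_nonneg : ∀ t, 0 ≤ p t) (hs : Measurable s) {K : β × β → ℝ} (hK : Measurable K)
    (hK_int : ∀ᵐ x ∂μ, Integrable K ((κ x).prod (κ x))) :
    HasUniformDeriv μ
      (fun t x => condMass κ (p t) x *
        ∫ b, K b ∂(condTilt κ (p t) x).prod (condTilt κ (p t) x))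
      (fun x => ∫ b, K b ∂(κ x).prod (κ x))
      (fun x => (∫ b, (s (x, b.1) + s (x, b.2)) * K b ∂(κ x).prod (κ x)) -
        (∫ b, K b ∂(κ x).prod (κ x)) * condMass κ s x)
      (fun x => ∫ b, |K b| ∂(κ x).prod (κ x)) := by
  have pairs := (h.mul_pair.mul (.const fun q : α × (β × β) => K q.2)).integral_kernel
    (.of_forall fun t => by have := hp t; fun_prop) (by fun_prop) (by fun_prop)
    (by simpa only [Kernel.prod_apply, one_mul] using hK_int)
  have quotient := pairs.mul ((h.condMass hp hs).inv (.of_forall fun _ => one_ne_zero))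
  simpa [Kernel.prod_apply, ContrastEffect.condMass_mul_integral_condTilt_prod (hp _) (hp_nonneg _),
    sub_eq_add_neg] using quotient

end Pairs

section Covariance

variable {ν : Measure (ℝ × ℝ)} {f g σ : ℝ × ℝ → ℝ}

/-- The mean of `σ` times the product of the centered `f` and `g`: the derivative of the total
mass times the covariance of `f` and `g` when the law `ν` is tilted in the direction `σ`. -/
noncomputable def weightedCov (f g σ : ℝ × ℝ → ℝ) (ν : Measure (ℝ × ℝ)) : ℝ :=
  ∫ a, σ a * ((f a - ∫ b, f b ∂ν) * (g a - ∫ b, g b ∂ν)) ∂ν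

theorem weightedCov_one : weightedCov f g (fun _ => 1) ν = covariance f g ν := by
  simp only [weightedCov, covariance, one_mul]

variable [IsProbabilityMeasure ν]

theorem CovExists.integrable_centered (h : CovExists f g ν) :
    Integrable (fun a => (f a - ∫ b, f b ∂ν) * (g a - ∫ b, g b ∂ν)) ν := by
  obtain ⟨f_int, g_int, mul_int⟩ := h
  refine (((mul_int.sub (g_int.const_mul (∫ b, f b ∂ν))).sub (f_int.mul_const (∫ b, g b ∂ν))).add
    (integrable_const ((∫ b, f b ∂ν) * ∫ b, g b ∂ν))).congr (.of_forall fun a => ?_)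
  simp only [Pi.add_apply, Pi.sub_apply]
  ring

theorem CovExists.integrable_pair (h : CovExists f g ν) :
    Integrable (fun b : (ℝ × ℝ) × (ℝ × ℝ) => (f b.1 - f b.2) * (g b.1 - g b.2)) (ν.prod ν) := by
  obtain ⟨f_int, g_int, mul_int⟩ := h
  refine ((((mul_int.comp_fst ν).add (mul_int.comp_snd ν)).sub (f_int.mul_prod g_int)).sub
    (g_int.mul_prod f_int)).congr (.of_forall fun b => ?_)
  simp only [Pi.add_apply, Pi.sub_apply]
  ring

theorem CovExists.integral_pair_snd (h : CovExists f g ν) (a : ℝ × ℝ) :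
    ∫ b, (f a - f b) * (g a - g b) ∂ν =
      (f a - ∫ b, f b ∂ν) * (g a - ∫ b, g b ∂ν) + covariance f g ν := by
  set u := f a - ∫ b, f b ∂ν with hu
  set w := g a - ∫ b, g b ∂ν with hw
  have f_int : Integrable (fun b => f b - ∫ b, f b ∂ν) ν := h.1.sub (integrable_const _)
  have g_int : Integrable (fun b => g b - ∫ b, g b ∂ν) ν := h.2.1.sub (integrable_const _)
  have f_centered : ∫ b, (f b - ∫ b, f b ∂ν) ∂ν = 0 := by simp [integral_sub h.1]
  have g_centered : ∫ b, (g b - ∫ b, g b ∂ν) ∂ν = 0 := by simp [integral_sub h.2.1]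
  calc ∫ b, (f a - f b) * (g a - g b) ∂ν
      = ∫ b, u * w - u * (g b - ∫ b, g b ∂ν) - (f b - ∫ b, f b ∂ν) * w
          + (f b - ∫ b, f b ∂ν) * (g b - ∫ b, g b ∂ν) ∂ν := by
        congr with b
        rw [hu, hw]
        ring
    _ = u * w + covariance f g ν := by
        rw [integral_add (f := fun b => u * w - u * (g b - ∫ b, g b ∂ν) - (f b - ∫ b, f b ∂ν) * w)
            (((integrable_const _).sub (g_int.const_mul u)).sub (f_int.mul_const w))
            h.integrable_centered,
          integral_sub (f := fun b => u * w - u * (g b - ∫ b, g b ∂ν))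
            ((integrable_const _).sub (g_int.const_mul u)) (f_int.mul_const w),
          integral_sub (f := fun _ => u * w) (integrable_const _) (g_int.const_mul u),
          integral_const, integral_const_mul, integral_mul_const, f_centered, g_centered,
          covariance]
        simp

theorem CovExists.integral_pair_mul_fst (h : CovExists f g ν) (hσ : Measurable σ) {B : ℝ}
    (hB : ∀ a, |σ a| ≤ B) :
    ∫ b, σ b.1 * ((f b.1 - f b.2) * (g b.1 - g b.2)) ∂ν.prod ν =
      weightedCov f g σ ν + covariance f g ν * ∫ a, σ a ∂ν := by
  have pair_int : Integrable
      (fun b : (ℝ × ℝ) × (ℝ × ℝ) => σ b.1 * ((f b.1 - f b.2) * (g b.1 - g b.2))) (ν.prod ν) :=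
    h.integrable_pair.bdd_mul (hσ.comp measurable_fst).aestronglyMeasurable
      (.of_forall fun b => hB b.1)
  have σ_int : Integrable σ ν := .of_bound hσ.aestronglyMeasurable B (.of_forall hB)
  rw [integral_prod _ pair_int, weightedCov, ← integral_const_mul, ← integral_add
    (h.integrable_centered.bdd_mul hσ.aestronglyMeasurable (.of_forall hB)) (σ_int.const_mul _)]
  congr with a
  simp only [integral_const_mul, h.integral_pair_snd]
  ring

theorem CovExists.integral_pair (h : CovExists f g ν) :
    ∫ b, (f b.1 - f b.2) * (g b.1 - g b.2) ∂ν.prod ν = 2 * covariance f g ν := by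
  have := h.integral_pair_mul_fst (σ := fun _ => 1) measurable_const (fun _ => abs_one.le)
  simp only [one_mul, weightedCov_one, integral_const, probReal_univ, one_smul] at this
  rw [this]
  ring

theorem CovExists.integral_pair_mul_add (h : CovExists f g ν) (hσ : Measurable σ) {B : ℝ}
    (hB : ∀ a, |σ a| ≤ B) :
    ∫ b, (σ b.1 + σ b.2) * ((f b.1 - f b.2) * (g b.1 - g b.2)) ∂ν.prod ν =
      2 * (weightedCov f g σ ν + covariance f g ν * ∫ a, σ a ∂ν) := by
  have swap : ∫ b, σ b.2 * ((f b.1 - f b.2) * (g b.1 - g b.2)) ∂ν.prod ν =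
      ∫ b, σ b.1 * ((f b.1 - f b.2) * (g b.1 - g b.2)) ∂ν.prod ν := by
    rw [← integral_prod_swap]
    congr with b
    simp only [Prod.fst_swap, Prod.snd_swap]
    ring
  have fst_int := h.integrable_pair.bdd_mul (f := fun b => σ b.1)
    (hσ.comp measurable_fst).aestronglyMeasurable (.of_forall fun b => hB b.1)
  have snd_int := h.integrable_pair.bdd_mul (f := fun b => σ b.2)
    (hσ.comp measurable_snd).aestronglyMeasurable (.of_forall fun b => hB b.2)
  simp only [add_mul]
  rw [integral_add fst_int snd_int, swap, h.integral_pair_mul_fst hσ hB]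
  ring

theorem CovExists.abs_weightedCov_le (h : CovExists f g ν) (hσ : Measurable σ) {B : ℝ}
    (hB : ∀ a, |σ a| ≤ B) : |weightedCov f g σ ν| ≤ 2 * B * absCov f g ν := by
  have cov_le : |covariance f g ν| ≤ absCov f g ν := by
    have := h.integral_pair ▸ abs_integral_le_integral_abs (μ := ν.prod ν)
      (f := fun b => (f b.1 - f b.2) * (g b.1 - g b.2))
    simp only [abs_mul, abs_two] at this
    rw [absCov]
    linarith [abs_nonneg (covariance f g ν)]
  have pair_le : |∫ b, σ b.1 * ((f b.1 - f b.2) * (g b.1 - g b.2)) ∂ν.prod ν| ≤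
      B * absCov f g ν := by
    rw [absCov, ← integral_const_mul, ← Real.norm_eq_abs]
    refine norm_integral_le_of_norm_le ?_ (.of_forall fun b => ?_)
    · simpa only [abs_mul] using h.integrable_pair.abs.const_mul B
    · rw [Real.norm_eq_abs, abs_mul, abs_mul]
      exact mul_le_mul_of_nonneg_right (hB b.1) (by positivity)
  have mean_le : |∫ a, σ a ∂ν| ≤ B := by
    simpa using norm_integral_le_of_norm_le_const (μ := ν) (f := σ) (.of_forall hB)
  calc |weightedCov f g σ ν|
      = |∫ b, σ b.1 * ((f b.1 - f b.2) * (g b.1 - g b.2)) ∂ν.prod ν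
          - covariance f g ν * ∫ a, σ a ∂ν| := by
        rw [h.integral_pair_mul_fst hσ hB, add_sub_cancel_right]
    _ ≤ B * absCov f g ν + absCov f g ν * B := by
        refine (abs_sub _ _).trans (add_le_add pair_le ?_)
        rw [abs_mul]
        exact mul_le_mul cov_le mean_le (abs_nonneg _) ((abs_nonneg _).trans cov_le)
    _ = 2 * B * absCov f g ν := by ring

section Residual

variable {h : ℝ × ℝ → ℝ} {B : ℝ}

theorem CovExists.integrable_mul_residual (hfg : CovExists f g ν) (hfh : CovExists f h ν)
    (hσ : Measurable σ) (hB : ∀ a, |σ a| ≤ B) (θ : ℝ) :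
    Integrable (fun a => σ a *
      ((f a - ∫ b, f b ∂ν) * (g a - (∫ b, g b ∂ν + θ * (h a - ∫ b, h b ∂ν))))) ν := by
  refine ((hfg.integrable_centered.sub (hfh.integrable_centered.const_mul θ)).congr
    (.of_forall fun a => ?_)).bdd_mul hσ.aestronglyMeasurable (.of_forall hB)
  simp only [Pi.sub_apply]
  ring

theorem CovExists.integral_mul_residual (hfg : CovExists f g ν) (hfh : CovExists f h ν)
    (hσ : Measurable σ) (hB : ∀ a, |σ a| ≤ B) (θ : ℝ) :
    ∫ a, σ a * ((f a - ∫ b, f b ∂ν) * (g a - (∫ b, g b ∂ν + θ * (h a - ∫ b, h b ∂ν)))) ∂ν =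
      weightedCov f g σ ν - θ * weightedCov f h σ ν := by
  have g_int := hfg.integrable_centered.bdd_mul hσ.aestronglyMeasurable (.of_forall hB)
  have h_int := hfh.integrable_centered.bdd_mul hσ.aestronglyMeasurable (.of_forall hB)
  rw [weightedCov, weightedCov, ← integral_const_mul, ← integral_sub g_int (h_int.const_mul θ)]
  congr with a
  ring

end Residual

end Covariance

section TiltFamily

variable {α β : Type*} [MeasurableSpace α] [MeasurableSpace β]

theorem integrable_withDensity_ofReal_iff {μ : Measure α} {r F : α → ℝ} (hr : Measurable r)
    (hr_nonneg : 0 ≤ r) :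
    Integrable F (μ.withDensity fun x => ENNReal.ofReal (r x)) ↔
      Integrable (fun x => r x * F x) μ := by
  rw [integrable_withDensity_iff_integrable_smul' hr.ennreal_ofReal
    (.of_forall fun x => ENNReal.ofReal_lt_top)]
  simp only [ENNReal.toReal_ofReal (hr_nonneg _), smul_eq_mul]

theorem integral_withDensity_ofReal {μ : Measure α} {r : α → ℝ} (hr : Measurable r)
    (hr_nonneg : 0 ≤ r) (F : α → ℝ) :
    ∫ x, F x ∂μ.withDensity (fun x => ENNReal.ofReal (r x)) = ∫ x, r x * F x ∂μ := by
  rw [integral_withDensity_eq_integral_toReal_smul hr.ennreal_ofReal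
    (.of_forall fun x => ENNReal.ofReal_lt_top)]
  simp only [ENNReal.toReal_ofReal (hr_nonneg _), smul_eq_mul]

/-- A family `p t` of densities with respect to `μ ⊗ₘ κ`, equal to `1 + t s + o(t)` uniformly, with
bounded score `s`: a submodel through `μ ⊗ₘ κ`, disintegrated over the first coordinate. The total
mass is not required to be one. -/
structure IsTiltFamily (μ : Measure α) (κ : Kernel α β) (s : α × β → ℝ) (p : ℝ → α × β → ℝ) :
    Prop where
  measurable_score : Measurable s
  bounded_score : ∃ B, ∀ q, |s q| ≤ B
  measurable (t : ℝ) : Measurable (p t)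
  nonneg (t : ℝ) : 0 ≤ p t
  hasUniformDeriv : HasUniformDeriv (μ ⊗ₘ κ) p (fun _ => 1) s fun _ => 1

namespace IsTiltFamily

variable {μ : Measure α} [SFinite μ] {s : α × β → ℝ} {p : ℝ → α × β → ℝ}

section Kernel

variable {κ : Kernel α β} [IsMarkovKernel κ]

theorem hasUniformDeriv_condMass (h : IsTiltFamily μ κ s p) :
    HasUniformDeriv μ (fun t => condMass κ (p t)) (fun _ => 1) (condMass κ s) fun _ => 1 :=
  h.hasUniformDeriv.condMass h.measurable h.measurable_score

theorem eventually_condMass_ne_zero (h : IsTiltFamily μ κ s p) :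
    ∀ᶠ t in 𝓝 0, ∀ᵐ x ∂μ, condMass κ (p t) x ≠ 0 :=
  h.hasUniformDeriv_condMass.eventually_ne_zero (.of_forall fun _ => one_ne_zero)

theorem eventually_absolutelyContinuous (h : IsTiltFamily μ κ s p) :
    ∀ᶠ t in 𝓝 0, μ ≪ μ.withDensity fun x => ENNReal.ofReal (condMass κ (p t) x) := by
  filter_upwards [h.eventually_condMass_ne_zero] with t ht
  refine withDensity_absolutelyContinuous'
    (measurable_condMass (h.measurable t)).ennreal_ofReal.aemeasurable ?_
  filter_upwards [ht] with x hx
  exact (ENNReal.ofReal_pos.2 ((condMass_nonneg (h.nonneg t) x).lt_of_ne' hx)).ne'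

theorem eventually_isProbabilityMeasure_condTilt (h : IsTiltFamily μ κ s p) :
    ∀ᶠ t in 𝓝 0, ∀ᵐ x ∂μ, IsProbabilityMeasure (condTilt κ (p t) x) := by
  filter_upwards [h.eventually_condMass_ne_zero] with t ht
  filter_upwards [ht] with x hx using
    isProbabilityMeasure_condTilt_apply (h.measurable t) (h.nonneg t) hx

theorem eventually_condTilt_le (h : IsTiltFamily μ κ s p) :
    ∀ᶠ t in 𝓝 0, ∃ c, ∀ᵐ x ∂μ,
      condTilt κ (p t) x ≤ ENNReal.ofReal (c / condMass κ (p t) x) • κ x := by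
  filter_upwards [h.hasUniformDeriv.eventually_isBigO] with t ht
  obtain ⟨c, hc⟩ := ht.bound
  refine ⟨c, ?_⟩
  filter_upwards [Measure.ae_ae_of_ae_compProd hc] with x hx
  rw [condTilt_apply (h.measurable t), ← withDensity_const]
  refine withDensity_mono ?_
  filter_upwards [hx] with y hy
  rw [norm_one, mul_one, Real.norm_eq_abs] at hy
  exact ENNReal.ofReal_le_ofReal
    (div_le_div_of_nonneg_right (le_of_abs_le hy) (condMass_nonneg (h.nonneg t) x))

theorem eventually_integrable_condTilt (h : IsTiltFamily μ κ s p) :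
    ∀ᶠ t in 𝓝 0, ∀ᵐ x ∂μ, ∀ f : β → ℝ, Integrable f (κ x) →
      Integrable f (condTilt κ (p t) x) := by
  filter_upwards [h.eventually_condTilt_le] with t ⟨c, hc⟩
  filter_upwards [hc] with x hx f hf using
    (hf.smul_measure ENNReal.ofReal_ne_top).mono_measure hx

end Kernel

section Covariance

variable {κ : Kernel α (ℝ × ℝ)} [IsMarkovKernel κ] {s : α × (ℝ × ℝ) → ℝ}
  {p : ℝ → α × (ℝ × ℝ) → ℝ} {f g : ℝ × ℝ → ℝ}

theorem eventually_covExists_condTilt (h : IsTiltFamily μ κ s p)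
    (hfg : ∀ᵐ x ∂μ, CovExists f g (κ x)) :
    ∀ᶠ t in 𝓝 0, ∀ᵐ x ∂μ, CovExists f g (condTilt κ (p t) x) := by
  filter_upwards [h.eventually_integrable_condTilt] with t ht
  filter_upwards [ht, hfg] with x transfer ⟨f_int, g_int, mul_int⟩
  exact ⟨transfer _ f_int, transfer _ g_int, transfer _ mul_int⟩

theorem hasUniformDeriv_covariance (h : IsTiltFamily μ κ s p) (hf : Measurable f)
    (hg : Measurable g) (hfg : ∀ᵐ x ∂μ, CovExists f g (κ x)) :
    HasUniformDeriv μ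
      (fun t x => condMass κ (p t) x * covariance f g (condTilt κ (p t) x))
      (fun x => covariance f g (κ x)) (fun x => weightedCov f g (fun a => s (x, a)) (κ x))
      (fun x => absCov f g (κ x)) := by
  obtain ⟨B, hB⟩ := h.bounded_score
  have pairs := h.hasUniformDeriv.condMass_mul_integral_condTilt_prod h.measurable h.nonneg
    h.measurable_score (K := fun b => (f b.1 - f b.2) * (g b.1 - g b.2)) (by fun_prop)
    (hfg.mono fun x hx => hx.integrable_pair)
  have half := (HasUniformDeriv.const (μ := μ) fun _ => (1 / 2 : ℝ)).mul pairs
  refine (half.mono_weight ?_).congr ?_ ?_ ?_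
  · simpa only [abs_mul, absCov] using isBigO_const_mul_self (1 / 2 : ℝ) _ (ae μ)
  · filter_upwards [h.eventually_covExists_condTilt hfg,
      h.eventually_isProbabilityMeasure_condTilt] with t covExists_t probability_t
    filter_upwards [covExists_t, probability_t] with x hx _
    rw [hx.integral_pair]
    ring
  · filter_upwards [hfg] with x hx
    rw [hx.integral_pair]
    ring
  · filter_upwards [hfg] with x hx
    rw [hx.integral_pair, hx.integral_pair_mul_add (σ := fun a => s (x, a))
      (h.measurable_score.comp measurable_prodMk_left) fun a => hB (x, a), condMass]
    simp only [Pi.zero_apply]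
    ring

theorem eventually_absCov_isBigO (h : IsTiltFamily μ κ s p) (hf : Measurable f)
    (hg : Measurable g) (hfg : ∀ᵐ x ∂μ, CovExists f g (κ x)) :
    ∀ᶠ t in 𝓝 0, (fun x => condMass κ (p t) x * absCov f g (condTilt κ (p t) x))
      =O[ae μ] fun x => absCov f g (κ x) := by
  have pairs := h.hasUniformDeriv.condMass_mul_integral_condTilt_prod h.measurable h.nonneg
    h.measurable_score (K := fun b => |f b.1 - f b.2| * |g b.1 - g b.2|) (by fun_prop)
    (hfg.mono fun x hx => by simpa only [abs_mul] using hx.integrable_pair.abs)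
  simpa only [abs_mul, abs_abs, absCov] using pairs.eventually_isBigO

end Covariance

end IsTiltFamily

end TiltFamily

section Measurability

variable {α : Type*} [MeasurableSpace α] (κ : Kernel α (ℝ × ℝ)) [IsSFiniteKernel κ]
  {f g : ℝ × ℝ → ℝ}

theorem measurable_weightedCov {s : α × (ℝ × ℝ) → ℝ} (hf : Measurable f) (hg : Measurable g)
    (hs : Measurable s) : Measurable fun x => weightedCov f g (fun a => s (x, a)) (κ x) := by
  have mean_meas {k : ℝ × ℝ → ℝ} (hk : Measurable k) : Measurable fun x => ∫ a, k a ∂κ x :=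
    measurable_condMass (κ := κ) (p := fun q => k q.2) (by fun_prop)
  have f_mean_meas := mean_meas hf
  have g_mean_meas := mean_meas hg
  exact measurable_condMass (κ := κ) (p := fun q => s q *
    ((f q.2 - ∫ b, f b ∂κ q.1) * (g q.2 - ∫ b, g b ∂κ q.1))) <|
    hs.mul (((hf.comp measurable_snd).sub (f_mean_meas.comp measurable_fst)).mul
      ((hg.comp measurable_snd).sub (g_mean_meas.comp measurable_fst)))

theorem measurable_covariance (hf : Measurable f) (hg : Measurable g) :
    Measurable fun x => covariance f g (κ x) := by
  simpa only [weightedCov_one] using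
    measurable_weightedCov κ (s := fun _ => 1) hf hg measurable_const

theorem measurable_absCov (hf : Measurable f) (hg : Measurable g) :
    Measurable fun x => absCov f g (κ x) := by
  simp only [absCov, ← Kernel.prod_apply]
  exact measurable_condMass (κ := κ ×ₖ κ)
    (p := fun q => |f q.2.1 - f q.2.2| * |g q.2.1 - g q.2.2|) (by fun_prop)

end Measurability

section Disintegration

variable {𝒵 : Type*} [MeasurableSpace 𝒵]

theorem map_withDensity_equiv {α β : Type*} [MeasurableSpace α] [MeasurableSpace β] {μ : Measure α}
    (e : α ≃ᵐ β) (f : α → ENNReal) :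
    (μ.withDensity f).map e = (μ.map e).withDensity (f ∘ e.symm) := by
  ext s hs
  rw [e.map_apply, withDensity_apply _ (e.measurable hs), withDensity_apply _ hs,
    e.restrict_map, lintegral_map_equiv]
  simp only [Function.comp_apply, e.symm_apply_apply]

/-- The observation `(y, x, z)` rearranged as `(z, (y, x))`. -/
def obsEquiv : Obs 𝒵 ≃ᵐ 𝒵 × (ℝ × ℝ) :=
  MeasurableEquiv.prodAssoc.symm.trans MeasurableEquiv.prodComm

instance isProbabilityMeasure_lawZ (Q : ProbabilityMeasure (Obs 𝒵)) :
    IsProbabilityMeasure (lawZ Q) :=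
  Measure.isProbabilityMeasure_map (by fun_prop)

instance isMarkovKernel_condLaw (Q : ProbabilityMeasure (Obs 𝒵)) : IsMarkovKernel (condLaw Q) :=
  inferInstanceAs (IsMarkovKernel (condDistrib _ _ _))

theorem measurePreserving_obsEquiv (Q : ProbabilityMeasure (Obs 𝒵)) :
    MeasurePreserving obsEquiv (Q : Measure (Obs 𝒵)) (lawZ Q ⊗ₘ condLaw Q) :=
  ⟨obsEquiv.measurable,
    (compProd_map_condDistrib (X := fun o : Obs 𝒵 => o.2.2) (Y := fun o => (o.1, o.2.1))
      (by fun_prop)).symm⟩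

theorem integral_eq_integral_condLaw (Q : ProbabilityMeasure (Obs 𝒵)) {F : Obs 𝒵 → ℝ}
    (hF : Integrable F (Q : Measure (Obs 𝒵))) :
    ∫ o, F o ∂(Q : Measure (Obs 𝒵)) = ∫ z, ∫ a, F (a.1, a.2, z) ∂condLaw Q z ∂lawZ Q := by
  have preserving := (measurePreserving_obsEquiv Q).symm
  rw [← preserving.integral_comp' F]
  exact Measure.integral_compProd ((preserving.integrable_comp_emb
    obsEquiv.symm.measurableEmbedding).2 hF)

theorem compProd_eq_withDensity {P Q : ProbabilityMeasure (Obs 𝒵)} {r : Obs 𝒵 → ℝ}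
    (hQ : (Q : Measure (Obs 𝒵)) =
      (P : Measure (Obs 𝒵)).withDensity fun o => ENNReal.ofReal (r o)) :
    lawZ Q ⊗ₘ condLaw Q = (lawZ P ⊗ₘ condLaw P).withDensity
      fun q => ENNReal.ofReal ((r ∘ obsEquiv.symm) q) := by
  rw [← (measurePreserving_obsEquiv Q).map_eq, ← (measurePreserving_obsEquiv P).map_eq, hQ,
    map_withDensity_equiv]
  rfl

theorem lawZ_eq_and_condLaw_ae_eq {P Q : ProbabilityMeasure (Obs 𝒵)} {r : 𝒵 × (ℝ × ℝ) → ℝ}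
    (hr : Measurable r) (hr_nonneg : 0 ≤ r)
    (hQ : lawZ Q ⊗ₘ condLaw Q =
      (lawZ P ⊗ₘ condLaw P).withDensity fun q => ENNReal.ofReal (r q)) :
    lawZ Q = (lawZ P).withDensity (fun z => ENNReal.ofReal (condMass (condLaw P) r z)) ∧
      ∀ᵐ z ∂lawZ Q, condLaw Q z = condTilt (condLaw P) r z := by
  have r_int : Integrable r (lawZ P ⊗ₘ condLaw P) := by
    refine ⟨hr.aestronglyMeasurable, ?_⟩
    rw [hasFiniteIntegral_iff_ofReal (.of_forall hr_nonneg), ← setLIntegral_univ,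
      ← withDensity_apply _ .univ, ← hQ]
    exact measure_lt_top _ _
  have slice_int := ((Measure.integrable_compProd_iff hr.aestronglyMeasurable).1 r_int).1
  have lawZ_eq :
      lawZ Q = (lawZ P).withDensity fun z => ENNReal.ofReal (condMass (condLaw P) r z) := by
    rw [← Measure.fst_compProd (lawZ Q) (condLaw Q), hQ,
      fst_withDensity_compProd hr hr_nonneg slice_int]
  refine ⟨lawZ_eq, ?_⟩
  have := isFiniteKernel_condTilt (κ := condLaw P) hr hr_nonneg
  refine condDistrib_ae_eq_of_measure_eq_compProd _ (by fun_prop) ?_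
  calc (Q : Measure (Obs 𝒵)).map obsEquiv = lawZ Q ⊗ₘ condLaw Q :=
        (measurePreserving_obsEquiv Q).map_eq
    _ = lawZ Q ⊗ₘ condTilt (condLaw P) r := by
        rw [hQ, withDensity_compProd hr hr_nonneg slice_int, ← lawZ_eq]

/-- The conditional mean of the score `s` given `Z = z`. -/
noncomputable def scoreMean (P : ProbabilityMeasure (Obs 𝒵)) (s : Obs 𝒵 → ℝ) (z : 𝒵) : ℝ :=
  ∫ a, s (a.1, a.2, z) ∂condLaw P z

theorem condMass_comp_obsEquiv_symm (P : ProbabilityMeasure (Obs 𝒵)) (s : Obs 𝒵 → ℝ) :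
    condMass (condLaw P) (s ∘ obsEquiv.symm) = scoreMean P s :=
  rfl

theorem scoreMean_one (P : ProbabilityMeasure (Obs 𝒵)) (z : 𝒵) :
    scoreMean P (fun _ => 1) z = 1 := by
  simp [scoreMean]

/-- The submodel `Q` through `P` with score `s` is disintegrated over `Z` with densities `p`: near
`t = 0` the law of `Z` under `Q t` has density `condMass (condLaw P) (p t)` with respect to its law
under `P`, and the conditional law of `(Y, X)` is tilted by `p t`. -/
structure IsDisintegration (P : ProbabilityMeasure (Obs 𝒵)) (s : Obs 𝒵 → ℝ)
    (Q : ℝ → ProbabilityMeasure (Obs 𝒵)) (p : ℝ → 𝒵 × (ℝ × ℝ) → ℝ) : Prop extends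
    IsTiltFamily (lawZ P) (condLaw P) (s ∘ obsEquiv.symm) p where
  lawZ_eq : ∀ᶠ t in 𝓝 0, lawZ (Q t) =
    (lawZ P).withDensity fun z => ENNReal.ofReal (condMass (condLaw P) (p t) z)
  condLaw_eq : ∀ᶠ t in 𝓝 0, ∀ᵐ z ∂lawZ P, condLaw (Q t) z = condTilt (condLaw P) (p t) z

theorem IsSubmodel.exists_isDisintegration {P : ProbabilityMeasure (Obs 𝒵)} {s : Obs 𝒵 → ℝ}
    {Q : ℝ → ProbabilityMeasure (Obs 𝒵)} (h : IsSubmodel P s Q) :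
    ∃ p, IsDisintegration P s Q p := by
  obtain ⟨hs, ⟨B, hB⟩, r, hr, hr_nonneg, hQ, hr_expansion⟩ := h
  have tilt : IsTiltFamily (lawZ P) (condLaw P) (s ∘ obsEquiv.symm)
      fun t => r t ∘ obsEquiv.symm := {
    measurable_score := hs.comp obsEquiv.symm.measurable
    bounded_score := ⟨B, fun q => hB _⟩
    measurable := fun t => (hr t).comp obsEquiv.symm.measurable
    nonneg := fun t q => hr_nonneg t _
    hasUniformDeriv := {
      isBigO := isBigO_refl _ _
      isBigO_deriv := .of_bound B (.of_forall fun q => by simpa using hB _)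
      isLittleO := isLittleO_iff.2 fun ε hε => eventually_curry_iff.2 <| by
        filter_upwards [hr_expansion ε hε] with t ht
        filter_upwards [(measurePreserving_obsEquiv P).symm.quasiMeasurePreserving.ae ht]
          with q hq
        simpa using hq } }
  have disintegration : ∀ᶠ t in 𝓝 0, lawZ (Q t) = _ ∧ _ := hQ.mono fun t ht =>
    lawZ_eq_and_condLaw_ae_eq (tilt.measurable t) (tilt.nonneg t) (compProd_eq_withDensity ht)
  refine ⟨_, tilt, disintegration.mono fun t ht => ht.1, ?_⟩
  filter_upwards [disintegration, tilt.eventually_absolutelyContinuous]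
    with t ⟨lawZ_eq, condLaw_eq⟩ abs_cont
  rw [← lawZ_eq] at abs_cont
  exact abs_cont.ae_le condLaw_eq

namespace IsDisintegration

variable {P : ProbabilityMeasure (Obs 𝒵)} {s : Obs 𝒵 → ℝ} {Q : ℝ → ProbabilityMeasure (Obs 𝒵)}
  {p : ℝ → 𝒵 × (ℝ × ℝ) → ℝ} {f g : ℝ × ℝ → ℝ}

theorem eventually_lawZ_absolutelyContinuous (h : IsDisintegration P s Q p) :
    ∀ᶠ t in 𝓝 0, lawZ (Q t) ≪ lawZ P := by
  filter_upwards [h.lawZ_eq] with t ht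
  rw [ht]
  exact withDensity_absolutelyContinuous _ _

theorem eventually_integrable_lawZ_iff (h : IsDisintegration P s Q p) :
    ∀ᶠ t in 𝓝 0, ∀ F : 𝒵 → ℝ, Integrable F (lawZ (Q t)) ↔
      Integrable (fun z => condMass (condLaw P) (p t) z * F z) (lawZ P) := by
  filter_upwards [h.lawZ_eq] with t ht F
  rw [ht, integrable_withDensity_ofReal_iff (measurable_condMass (h.measurable t))
    (condMass_nonneg (h.nonneg t))]

theorem eventually_integral_lawZ (h : IsDisintegration P s Q p) :
    ∀ᶠ t in 𝓝 0, ∀ F : 𝒵 → ℝ, ∫ z, F z ∂lawZ (Q t) =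
      ∫ z, condMass (condLaw P) (p t) z * F z ∂lawZ P := by
  filter_upwards [h.lawZ_eq] with t ht F
  rw [ht, integral_withDensity_ofReal (measurable_condMass (h.measurable t))
    (condMass_nonneg (h.nonneg t))]

theorem integrable_scoreMean (h : IsDisintegration P s Q p) :
    Integrable (scoreMean P s) (lawZ P) :=
  integrable_of_isBigO_ae (integrable_const 1)
    (measurable_condMass h.measurable_score).aestronglyMeasurable
    h.hasUniformDeriv_condMass.isBigO_deriv

theorem integral_scoreMean (h : IsDisintegration P s Q p) : ∫ z, scoreMean P s z ∂lawZ P = 0 := by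
  have total_mass_deriv := h.hasUniformDeriv_condMass.hasDerivAt_integral
    (.of_forall fun t => (measurable_condMass (h.measurable t)).aestronglyMeasurable)
    aestronglyMeasurable_const (measurable_condMass h.measurable_score).aestronglyMeasurable
    (integrable_const 1)
  refine total_mass_deriv.unique ((hasDerivAt_const 0 1).congr_of_eventuallyEq ?_)
  filter_upwards [h.eventually_integral_lawZ] with t ht
  simpa using (ht fun _ => 1).symm

theorem hasUniformDeriv_condMass_mul_covariance (h : IsDisintegration P s Q p)
    (hf : Measurable f) (hg : Measurable g) (hfg : ∀ᵐ z ∂lawZ P, CovExists f g (condLaw P z)) :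
    HasUniformDeriv (lawZ P)
      (fun t z => condMass (condLaw P) (p t) z * covariance f g (condLaw (Q t) z))
      (fun z => covariance f g (condLaw P z))
      (fun z => weightedCov f g (fun a => s (a.1, a.2, z)) (condLaw P z))
      (fun z => absCov f g (condLaw P z)) := by
  refine (h.hasUniformDeriv_covariance hf hg hfg).congr ?_ .rfl .rfl
  filter_upwards [h.condLaw_eq] with t ht
  filter_upwards [ht] with z hz
  rw [hz]

theorem eventually_condMass_mul_absCov_isBigO (h : IsDisintegration P s Q p)
    (hf : Measurable f) (hg : Measurable g) (hfg : ∀ᵐ z ∂lawZ P, CovExists f g (condLaw P z)) :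
    ∀ᶠ t in 𝓝 0, (fun z => condMass (condLaw P) (p t) z * absCov f g (condLaw (Q t) z))
      =O[ae (lawZ P)] fun z => absCov f g (condLaw P z) := by
  filter_upwards [h.eventually_absCov_isBigO hf hg hfg, h.condLaw_eq] with t ht condLaw_eq_t
  refine ht.congr' ?_ .rfl
  filter_upwards [condLaw_eq_t] with z hz
  rw [hz]

theorem eventually_covExists (h : IsDisintegration P s Q p)
    (hfg : ∀ᵐ z ∂lawZ P, CovExists f g (condLaw P z)) :
    ∀ᶠ t in 𝓝 0, ∀ᵐ z ∂lawZ (Q t), CovExists f g (condLaw (Q t) z) := by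
  filter_upwards [h.eventually_covExists_condTilt hfg, h.condLaw_eq,
    h.eventually_lawZ_absolutelyContinuous] with t ht condLaw_eq_t abs_cont
  refine abs_cont.ae_le ?_
  filter_upwards [ht, condLaw_eq_t] with z hz condLaw_eq_z
  rwa [condLaw_eq_z]

theorem eventually_condCovExist {v : ℝ → ℝ} (h : IsDisintegration P s Q p)
    (hP : CondCovExist v P) : ∀ᶠ t in 𝓝 0, CondCovExist v (Q t) := by
  filter_upwards [h.eventually_covExists (hP.mono fun z hz => hz.1),
    h.eventually_covExists (hP.mono fun z hz => hz.2)] with t hy hx using hy.and hx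

theorem eventually_integrable_absCov (h : IsDisintegration P s Q p)
    (hf : Measurable f) (hg : Measurable g) (hfg : ∀ᵐ z ∂lawZ P, CovExists f g (condLaw P z))
    (hint : Integrable (fun z => absCov f g (condLaw P z)) (lawZ P)) :
    ∀ᶠ t in 𝓝 0, Integrable (fun z => absCov f g (condLaw (Q t) z)) (lawZ (Q t)) := by
  filter_upwards [h.eventually_integrable_lawZ_iff,
    h.eventually_condMass_mul_absCov_isBigO hf hg hfg] with t iff_t isBigO_t
  exact (iff_t _).2 <| integrable_of_isBigO_ae hint ((measurable_condMass (h.measurable t)).mul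
    (measurable_absCov _ hf hg)).aestronglyMeasurable isBigO_t

theorem hasDerivAt_integral_covariance (h : IsDisintegration P s Q p)
    (hf : Measurable f) (hg : Measurable g) (hfg : ∀ᵐ z ∂lawZ P, CovExists f g (condLaw P z))
    (hint : Integrable (fun z => absCov f g (condLaw P z)) (lawZ P)) :
    HasDerivAt (fun t => ∫ z, covariance f g (condLaw (Q t) z) ∂lawZ (Q t))
      (∫ z, weightedCov f g (fun a => s (a.1, a.2, z)) (condLaw P z) ∂lawZ P) 0 := by
  have deriv := (h.hasUniformDeriv_condMass_mul_covariance hf hg hfg).hasDerivAt_integral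
    (.of_forall fun t => ((measurable_condMass (h.measurable t)).mul
      (measurable_covariance _ hf hg)).aestronglyMeasurable)
    (measurable_covariance _ hf hg).aestronglyMeasurable
    (measurable_weightedCov _ hf hg h.measurable_score).aestronglyMeasurable hint
  refine deriv.congr_of_eventuallyEq ?_
  filter_upwards [h.eventually_integral_lawZ] with t ht using ht _

end IsDisintegration

end Disintegration

section InfluenceCurves

variable {𝒵 : Type*} [MeasurableSpace 𝒵] {v : ℝ → ℝ} {P : ProbabilityMeasure (Obs 𝒵)}
  {s : Obs 𝒵 → ℝ}

/-- The derivative of `γ(z)` times the density of the law of `Z`, along a submodel through `P` with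
score `s`. -/
noncomputable def covVYDeriv (v : ℝ → ℝ) (P : ProbabilityMeasure (Obs 𝒵)) (s : Obs 𝒵 → ℝ)
    (z : 𝒵) : ℝ :=
  weightedCov (fun a => v a.2) (fun a => a.1) (fun a => s (a.1, a.2, z)) (condLaw P z)

/-- The derivative of `β(z)` times the density of the law of `Z`, along a submodel through `P` with
score `s`. -/
noncomputable def covVXDeriv (v : ℝ → ℝ) (P : ProbabilityMeasure (Obs 𝒵)) (s : Obs 𝒵 → ℝ)
    (z : 𝒵) : ℝ :=
  weightedCov (fun a => v a.2) (fun a => a.2) (fun a => s (a.1, a.2, z)) (condLaw P z)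

theorem covVYDeriv_one (v : ℝ → ℝ) (P : ProbabilityMeasure (Obs 𝒵)) :
    covVYDeriv v P (fun _ => 1) = covVY v P :=
  funext fun _ => weightedCov_one

theorem covVXDeriv_one (v : ℝ → ℝ) (P : ProbabilityMeasure (Obs 𝒵)) :
    covVXDeriv v P (fun _ => 1) = covVX v P :=
  funext fun _ => weightedCov_one

theorem integrable_weightedCov_condLaw {f g : ℝ × ℝ → ℝ} (hf : Measurable f) (hg : Measurable g)
    (hfg : ∀ᵐ z ∂lawZ P, CovExists f g (condLaw P z))
    (hint : Integrable (fun z => absCov f g (condLaw P z)) (lawZ P)) (hs : Measurable s) {B : ℝ}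
    (hB : ∀ o, |s o| ≤ B) :
    Integrable (fun z => weightedCov f g (fun a => s (a.1, a.2, z)) (condLaw P z)) (lawZ P) := by
  refine (hint.const_mul (2 * B)).mono'
    (measurable_weightedCov _ hf hg (hs.comp obsEquiv.symm.measurable)).aestronglyMeasurable ?_
  filter_upwards [hfg] with z hz
  exact hz.abs_weightedCov_le (σ := fun a => s (a.1, a.2, z)) (by fun_prop) fun a => hB _

section Residual

variable {z : 𝒵} {B : ℝ}

theorem integrable_contrast_mul_residual
    (hY : CovExists (fun a => v a.2) (fun a => a.1) (condLaw P z))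
    (hX : CovExists (fun a => v a.2) (fun a => a.2) (condLaw P z)) (hs : Measurable s)
    (hB : ∀ o, |s o| ≤ B) (θ : ℝ) :
    Integrable (fun a => contrast v (vMean v P) (covVX v P) a.2 z *
      (a.1 - (outcomeMean P z + θ * (a.2 - exposureMean P z))) * s (a.1, a.2, z))
      (condLaw P z) := by
  refine ((hY.integrable_mul_residual hX (σ := fun a => s (a.1, a.2, z)) (by fun_prop)
    (fun a => hB _) θ).div_const (covVX v P z)).congr (.of_forall fun a => ?_)
  simp only [contrast, vMean, outcomeMean, exposureMean]
  ring

theorem integral_contrast_mul_residual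
    (hY : CovExists (fun a => v a.2) (fun a => a.1) (condLaw P z))
    (hX : CovExists (fun a => v a.2) (fun a => a.2) (condLaw P z)) (hs : Measurable s)
    (hB : ∀ o, |s o| ≤ B) (θ : ℝ) :
    ∫ a, contrast v (vMean v P) (covVX v P) a.2 z *
        (a.1 - (outcomeMean P z + θ * (a.2 - exposureMean P z))) * s (a.1, a.2, z) ∂condLaw P z =
      (covVYDeriv v P s z - θ * covVXDeriv v P s z) / covVX v P z := by
  rw [covVYDeriv, covVXDeriv, ← hY.integral_mul_residual hX (σ := fun a => s (a.1, a.2, z))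
    (by fun_prop) (fun a => hB _), ← integral_div]
  congr with a
  rw [contrast, vMean, outcomeMean, exposureMean]
  ring

end Residual

section LambdaBar

theorem integral_covWeight (hP : P ∈ lambdaBarModel v) :
    ∫ z, covWeight v P z ∂lawZ P = 1 := by
  simp only [covWeight]
  rw [integral_div, div_self hP.2.2.2]

theorem lambdaBarEstimand_eq_integral_covWeight_mul_condEffect
    (hβ : ∀ᵐ z ∂lawZ P, covVX v P z ≠ 0) :
    lambdaBarEstimand v P = ∫ z, covWeight v P z * condEffect v P z ∂lawZ P := by
  rw [lambdaBarEstimand, ← integral_div]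
  refine integral_congr_ae ?_
  filter_upwards [hβ] with z hz
  rw [covWeight, condEffect, div_mul_div_cancel₀' hz]

theorem integrable_covVYDeriv (hv : Measurable v) (hP : P ∈ lambdaBarModel v) (hs : Measurable s)
    {B : ℝ} (hB : ∀ o, |s o| ≤ B) : Integrable (covVYDeriv v P s) (lawZ P) :=
  integrable_weightedCov_condLaw (by fun_prop) (by fun_prop) (hP.1.mono fun _ hz => hz.1) hP.2.1
    hs hB

theorem integrable_covVXDeriv (hv : Measurable v) (hP : P ∈ lambdaBarModel v) (hs : Measurable s)
    {B : ℝ} (hB : ∀ o, |s o| ≤ B) : Integrable (covVXDeriv v P s) (lawZ P) :=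
  integrable_weightedCov_condLaw (by fun_prop) (by fun_prop) (hP.1.mono fun _ hz => hz.2) hP.2.2.1
    hs hB

theorem integral_phiLambdaBar_mul (hv : Measurable v) (hP : P ∈ lambdaBarModel v)
    (hβ : ∀ᵐ z ∂lawZ P, covVX v P z ≠ 0)
    (hφ : Integrable (phiLambdaBar v P) (P : Measure (Obs 𝒵))) (hs : Measurable s) {B : ℝ}
    (hB : ∀ o, |s o| ≤ B) :
    ∫ o, phiLambdaBar v P o * s o ∂(P : Measure (Obs 𝒵)) =
      (∫ z, covVYDeriv v P s z ∂lawZ P -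
        lambdaBarEstimand v P * ∫ z, covVXDeriv v P s z ∂lawZ P) / ∫ z, covVX v P z ∂lawZ P := by
  have score_int : Integrable (fun o => phiLambdaBar v P o * s o) (P : Measure (Obs 𝒵)) :=
    hφ.mul_bdd hs.aestronglyMeasurable (.of_forall hB)
  rw [integral_eq_integral_condLaw P score_int, ← integral_const_mul, ← integral_sub
    (integrable_covVYDeriv hv hP hs hB) ((integrable_covVXDeriv hv hP hs hB).const_mul _),
    ← integral_div]
  refine integral_congr_ae ?_
  filter_upwards [hP.1, hβ] with z ⟨hY, hX⟩ hz
  calc ∫ a, phiLambdaBar v P (a.1, a.2, z) * s (a.1, a.2, z) ∂condLaw P z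
      = covWeight v P z * ((covVYDeriv v P s z - lambdaBarEstimand v P * covVXDeriv v P s z) /
          covVX v P z) := by
        rw [← integral_contrast_mul_residual hY hX hs hB, ← integral_const_mul]
        simp only [phiLambdaBar, icLambdaBar, mul_assoc]
    _ = _ := by
        rw [covWeight]
        field_simp

theorem integral_phiLambdaBar (hv : Measurable v) (hP : P ∈ lambdaBarModel v)
    (hβ : ∀ᵐ z ∂lawZ P, covVX v P z ≠ 0)
    (hφ : Integrable (phiLambdaBar v P) (P : Measure (Obs 𝒵))) :
    ∫ o, phiLambdaBar v P o ∂(P : Measure (Obs 𝒵)) = 0 := by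
  have mean := integral_phiLambdaBar_mul hv hP hβ hφ (s := fun _ => 1) measurable_const
    fun _ => abs_one.le
  simp only [mul_one, covVYDeriv_one, covVXDeriv_one] at mean
  rw [mean, lambdaBarEstimand, div_mul_cancel₀ _ hP.2.2.2, sub_self, zero_div]

theorem IsSubmodel.apply_zero {𝒪 : Type*} [MeasurableSpace 𝒪] {P : ProbabilityMeasure 𝒪}
    {s : 𝒪 → ℝ} {Q : ℝ → ProbabilityMeasure 𝒪} (h : IsSubmodel P s Q) : Q 0 = P := by
  obtain ⟨-, -, p, -, -, hQ, hp⟩ := h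
  have p_zero : (fun o => ENNReal.ofReal (p 0 o)) =ᵐ[(P : Measure 𝒪)] 1 := by
    filter_upwards [(hp 1 one_pos).self_of_nhds] with o ho
    have : p 0 o = 1 := by simpa [sub_eq_zero] using ho
    simp [this]
  exact Subtype.ext <|
    hQ.self_of_nhds.trans <| (withDensity_congr_ae p_zero).trans withDensity_one

variable {Q : ℝ → ProbabilityMeasure (Obs 𝒵)}

theorem IsSubmodel.hasDerivAt_integral_covVY (h : IsSubmodel P s Q) (hv : Measurable v)
    (hP : P ∈ lambdaBarModel v) :
    HasDerivAt (fun t => ∫ z, covVY v (Q t) z ∂lawZ (Q t)) (∫ z, covVYDeriv v P s z ∂lawZ P) 0 :=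
  let ⟨_, hp⟩ := h.exists_isDisintegration
  hp.hasDerivAt_integral_covariance (by fun_prop) (by fun_prop) (hP.1.mono fun _ hz => hz.1) hP.2.1

theorem IsSubmodel.hasDerivAt_integral_covVX (h : IsSubmodel P s Q) (hv : Measurable v)
    (hP : P ∈ lambdaBarModel v) :
    HasDerivAt (fun t => ∫ z, covVX v (Q t) z ∂lawZ (Q t)) (∫ z, covVXDeriv v P s z ∂lawZ P) 0 :=
  let ⟨_, hp⟩ := h.exists_isDisintegration
  hp.hasDerivAt_integral_covariance (by fun_prop) (by fun_prop) (hP.1.mono fun _ hz => hz.2)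
    hP.2.2.1

theorem IsSubmodel.eventually_mem_lambdaBarModel (h : IsSubmodel P s Q) (hv : Measurable v)
    (hP : P ∈ lambdaBarModel v) : ∀ᶠ t in 𝓝 0, Q t ∈ lambdaBarModel v := by
  obtain ⟨p, hp⟩ := h.exists_isDisintegration
  have covVX_ne_zero : ∀ᶠ t in 𝓝 0, ∫ z, covVX v (Q t) z ∂lawZ (Q t) ≠ 0 :=
    (h.hasDerivAt_integral_covVX hv hP).continuousAt.eventually_ne (by
      rw [h.apply_zero]
      exact hP.2.2.2)
  filter_upwards [hp.eventually_condCovExist hP.1,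
    hp.eventually_integrable_absCov (by fun_prop) (by fun_prop) (hP.1.mono fun _ hz => hz.1) hP.2.1,
    hp.eventually_integrable_absCov (by fun_prop) (by fun_prop) (hP.1.mono fun _ hz => hz.2)
      hP.2.2.1, covVX_ne_zero] with t covExist absCovVY_int absCovVX_int ne_zero
  exact ⟨covExist, absCovVY_int, absCovVX_int, ne_zero⟩

theorem IsSubmodel.hasDerivAt_lambdaBarEstimand (h : IsSubmodel P s Q) (hv : Measurable v)
    (hP : P ∈ lambdaBarModel v) :
    HasDerivAt (fun t => lambdaBarEstimand v (Q t))
      ((∫ z, covVYDeriv v P s z ∂lawZ P -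
        lambdaBarEstimand v P * ∫ z, covVXDeriv v P s z ∂lawZ P) / ∫ z, covVX v P z ∂lawZ P) 0 := by
  have quotient := (h.hasDerivAt_integral_covVY hv hP).fun_div (h.hasDerivAt_integral_covVX hv hP)
    (by simpa only [h.apply_zero] using hP.2.2.2)
  simp only [h.apply_zero] at quotient
  refine quotient.congr_deriv ?_
  have := hP.2.2.2
  rw [lambdaBarEstimand]
  field_simp

theorem isInfluenceFunction_phiLambdaBar (hv : Measurable v) (hP : P ∈ lambdaBarModel v)
    (hβ : ∀ᵐ z ∂lawZ P, covVX v P z ≠ 0)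
    (hφ : MemLp (phiLambdaBar v P) 2 (P : Measure (Obs 𝒵))) :
    IsInfluenceFunction (lambdaBarModel v) (lambdaBarEstimand v) P (phiLambdaBar v P) := by
  have φ_int := hφ.integrable one_le_two
  refine ⟨hφ, integral_phiLambdaBar hv hP hβ φ_int, fun s Q h => ?_⟩
  obtain ⟨B, hB⟩ := h.2.1
  refine ⟨h.eventually_mem_lambdaBarModel hv hP, ?_⟩
  rw [integral_phiLambdaBar_mul hv hP hβ φ_int h.1 hB]
  exact h.hasDerivAt_lambdaBarEstimand hv hP

end LambdaBar

section Lambda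

variable {w : 𝒵 → ℝ}

theorem measurable_covVY (hv : Measurable v) (Q : ProbabilityMeasure (Obs 𝒵)) :
    Measurable (covVY v Q) :=
  measurable_covariance _ (by fun_prop) measurable_fst

theorem measurable_covVX (hv : Measurable v) (Q : ProbabilityMeasure (Obs 𝒵)) :
    Measurable (covVX v Q) :=
  measurable_covariance _ (by fun_prop) measurable_snd

theorem measurable_condEffect (hv : Measurable v) (Q : ProbabilityMeasure (Obs 𝒵)) :
    Measurable (condEffect v Q) :=
  (measurable_covVY hv Q).div (measurable_covVX hv Q)

/-- The derivative of `w(z) λ(z)` times the density of the law of `Z`, along a submodel through `P`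
with score `s`. -/
noncomputable def weightedEffectDeriv (v : ℝ → ℝ) (w : 𝒵 → ℝ) (P : ProbabilityMeasure (Obs 𝒵))
    (s : Obs 𝒵 → ℝ) (z : 𝒵) : ℝ :=
  w z * ((covVYDeriv v P s z - condEffect v P z * covVXDeriv v P s z) / covVX v P z) +
    w z * condEffect v P z * scoreMean P s z

theorem weightedEffectDeriv_one (v : ℝ → ℝ) (w : 𝒵 → ℝ) (P : ProbabilityMeasure (Obs 𝒵)) (z : 𝒵) :
    weightedEffectDeriv v w P (fun _ => 1) z = w z * condEffect v P z := by
  have residual : (covVY v P z - condEffect v P z * covVX v P z) / covVX v P z = 0 := by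
    rw [sub_div, condEffect, mul_div_assoc]
    by_cases hz : covVX v P z = 0 <;> simp [hz]
  rw [weightedEffectDeriv, covVYDeriv_one, covVXDeriv_one, residual, scoreMean_one, mul_zero,
    zero_add, mul_one]

theorem measurable_weightedEffectDeriv (hv : Measurable v) (hw : Measurable w)
    (P : ProbabilityMeasure (Obs 𝒵)) (hs : Measurable (s ∘ obsEquiv.symm)) :
    Measurable (weightedEffectDeriv v w P s) := by
  have deriv_meas {g : ℝ × ℝ → ℝ} (hg : Measurable g) := measurable_weightedCov (condLaw P)
    (f := fun a => v a.2) (by fun_prop) hg hs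
  exact (hw.mul (((deriv_meas measurable_fst).sub ((measurable_condEffect hv P).mul
    (deriv_meas measurable_snd))).div (measurable_covVX hv P))).add
      ((hw.mul (measurable_condEffect hv P)).mul (measurable_condMass hs))

theorem absCovVX_isBigO_covVX (hP : P ∈ lambdaModel v w) :
    absCovVX v P =O[ae (lawZ P)] covVX v P := by
  obtain ⟨K, hK⟩ := hP.2.2.1
  refine .of_bound K (hK.mono fun z hz => (abs_of_nonneg ?_).trans_le hz)
  exact integral_nonneg fun _ => by positivity

theorem integral_phiLambda_mul (hP : P ∈ lambdaModel v w)
    (hφ : Integrable (phiLambda v w P) (P : Measure (Obs 𝒵))) (hs : Measurable s) {B : ℝ}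
    (hB : ∀ o, |s o| ≤ B) :
    ∫ o, phiLambda v w P o * s o ∂(P : Measure (Obs 𝒵)) =
      ∫ z, weightedEffectDeriv v w P s z - lambdaEstimand v w P * scoreMean P s z ∂lawZ P := by
  have score_int : Integrable (fun o => phiLambda v w P o * s o) (P : Measure (Obs 𝒵)) :=
    hφ.mul_bdd hs.aestronglyMeasurable (.of_forall hB)
  rw [integral_eq_integral_condLaw P score_int]
  refine integral_congr_ae ?_
  filter_upwards [hP.1] with z ⟨hY, hX⟩
  have s_int : Integrable (fun a => s (a.1, a.2, z)) (condLaw P z) :=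
    .of_bound (hs.comp (by fun_prop)).aestronglyMeasurable B (.of_forall fun a => hB _)
  calc ∫ a, phiLambda v w P (a.1, a.2, z) * s (a.1, a.2, z) ∂condLaw P z
      = w z * ((covVYDeriv v P s z - condEffect v P z * covVXDeriv v P s z) / covVX v P z) +
          (w z * condEffect v P z - lambdaEstimand v w P) * scoreMean P s z := by
        rw [← integral_contrast_mul_residual hY hX hs hB, scoreMean, ← integral_const_mul,
          ← integral_const_mul, ← integral_add
            ((integrable_contrast_mul_residual hY hX hs hB _).const_mul _) (s_int.const_mul _)]
        congr with a
        simp only [phiLambda, icLambda]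
        ring
    _ = _ := by
        rw [weightedEffectDeriv]
        ring

theorem integrable_weight_mul_condEffect (hv : Measurable v) (hw : Measurable w)
    (hP : P ∈ lambdaModel v w) : Integrable (fun z => w z * condEffect v P z) (lawZ P) := by
  have covVY_isBigO : covVY v P =O[ae (lawZ P)] absCovVY v P := by
    refine .of_bound 2 (hP.1.mono fun z hz => ?_)
    have := hz.1.abs_weightedCov_le (σ := fun _ => 1) measurable_const fun _ => abs_one.le
    rw [weightedCov_one, mul_one] at this
    exact this.trans (mul_le_mul_of_nonneg_left (le_abs_self _) zero_le_two)
  refine integrable_of_isBigO_ae hP.2.2.2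
    (hw.mul (measurable_condEffect hv P)).aestronglyMeasurable ?_
  simpa only [condEffect, div_eq_mul_inv, mul_assoc] using (isBigO_refl w _).mul
    (covVY_isBigO.mul (isBigO_refl (fun z => (covVX v P z)⁻¹) _))

theorem integral_phiLambda (hv : Measurable v) (hw : Measurable w) (hP : P ∈ lambdaModel v w)
    (hφ : Integrable (phiLambda v w P) (P : Measure (Obs 𝒵))) :
    ∫ o, phiLambda v w P o ∂(P : Measure (Obs 𝒵)) = 0 := by
  have mean := integral_phiLambda_mul hP hφ (s := fun _ => 1) measurable_const fun _ => abs_one.le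
  simp only [mul_one, weightedEffectDeriv_one, scoreMean_one] at mean
  rw [mean, integral_sub (integrable_weight_mul_condEffect hv hw hP) (integrable_const _),
    integral_const, probReal_univ, one_smul, lambdaEstimand, sub_self]

namespace IsDisintegration

variable {Q : ℝ → ProbabilityMeasure (Obs 𝒵)} {p : ℝ → 𝒵 × (ℝ × ℝ) → ℝ}

theorem hasUniformDeriv_condMass_mul_covVY (h : IsDisintegration P s Q p) (hv : Measurable v)
    (hP : P ∈ lambdaModel v w) :
    HasUniformDeriv (lawZ P) (fun t z => condMass (condLaw P) (p t) z * covVY v (Q t) z)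
      (covVY v P) (covVYDeriv v P s) (absCovVY v P) :=
  h.hasUniformDeriv_condMass_mul_covariance (by fun_prop) (by fun_prop)
    (hP.1.mono fun _ hz => hz.1)

theorem hasUniformDeriv_condMass_mul_covVX (h : IsDisintegration P s Q p) (hv : Measurable v)
    (hP : P ∈ lambdaModel v w) :
    HasUniformDeriv (lawZ P) (fun t z => condMass (condLaw P) (p t) z * covVX v (Q t) z)
      (covVX v P) (covVXDeriv v P s) (covVX v P) :=
  (h.hasUniformDeriv_condMass_mul_covariance (by fun_prop) (by fun_prop)
    (hP.1.mono fun _ hz => hz.2)).mono_weight (absCovVX_isBigO_covVX hP)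

theorem hasUniformDeriv_condMass_mul_condEffect (h : IsDisintegration P s Q p)
    (hv : Measurable v) (hP : P ∈ lambdaModel v w) :
    HasUniformDeriv (lawZ P)
      (fun t z => condMass (condLaw P) (p t) z * (w z * condEffect v (Q t) z))
      (fun z => w z * condEffect v P z) (weightedEffectDeriv v w P s)
      (fun z => w z * absCovVY v P z / covVX v P z) := by
  have ratio := (h.hasUniformDeriv_condMass_mul_covVY hv hP).mul
    ((h.hasUniformDeriv_condMass_mul_covVX hv hP).inv hP.2.1)
  have product := h.hasUniformDeriv_condMass.mul ((HasUniformDeriv.const w).mul ratio)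
  refine (product.mono_weight (K := fun z => w z * absCovVY v P z / covVX v P z)
    (EventuallyEq.isBigO <| .of_forall fun z => by ring)).congr ?_ ?_ ?_
  · filter_upwards [h.eventually_condMass_ne_zero] with t ht
    filter_upwards [ht] with z hz
    rw [condEffect, ← mul_div_mul_left _ _ hz, div_eq_mul_inv]
  · exact .of_forall fun z => by
      simp only [condEffect, div_eq_mul_inv, one_mul]
  · refine .of_forall fun z => ?_
    rw [condMass_comp_obsEquiv_symm]
    simp only [weightedEffectDeriv, condEffect, Pi.zero_apply]
    ring

theorem integrable_weightedEffectDeriv (h : IsDisintegration P s Q p) (hv : Measurable v)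
    (hw : Measurable w) (hP : P ∈ lambdaModel v w) :
    Integrable (weightedEffectDeriv v w P s) (lawZ P) :=
  integrable_of_isBigO_ae hP.2.2.2
    (measurable_weightedEffectDeriv hv hw P h.measurable_score).aestronglyMeasurable
    (h.hasUniformDeriv_condMass_mul_condEffect hv hP).isBigO_deriv

theorem hasDerivAt_lambdaEstimand (h : IsDisintegration P s Q p) (hv : Measurable v)
    (hw : Measurable w) (hP : P ∈ lambdaModel v w) :
    HasDerivAt (fun t => lambdaEstimand v w (Q t))
      (∫ z, weightedEffectDeriv v w P s z ∂lawZ P) 0 := by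
  have deriv := (h.hasUniformDeriv_condMass_mul_condEffect hv hP).hasDerivAt_integral
    (.of_forall fun t => ((measurable_condMass (h.measurable t)).mul
      (hw.mul (measurable_condEffect hv _))).aestronglyMeasurable)
    (hw.mul (measurable_condEffect hv _)).aestronglyMeasurable
    (measurable_weightedEffectDeriv hv hw P h.measurable_score).aestronglyMeasurable hP.2.2.2
  refine deriv.congr_of_eventuallyEq ?_
  filter_upwards [h.eventually_integral_lawZ] with t ht using ht _

theorem eventually_covVX_ne_zero (h : IsDisintegration P s Q p) (hv : Measurable v)
    (hP : P ∈ lambdaModel v w) :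
    ∀ᶠ t in 𝓝 0, ∀ᵐ z ∂lawZ (Q t), covVX v (Q t) z ≠ 0 := by
  filter_upwards [(h.hasUniformDeriv_condMass_mul_covVX hv hP).eventually_ne_zero hP.2.1,
    h.eventually_lawZ_absolutelyContinuous] with t ht abs_cont
  exact abs_cont.ae_le (ht.mono fun z hz => right_ne_zero_of_mul hz)

theorem eventually_absCovVX_le (h : IsDisintegration P s Q p) (hv : Measurable v)
    (hP : P ∈ lambdaModel v w) :
    ∀ᶠ t in 𝓝 0, ∃ K, ∀ᵐ z ∂lawZ (Q t), absCovVX v (Q t) z ≤ K * |covVX v (Q t) z| := by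
  filter_upwards [h.eventually_condMass_mul_absCov_isBigO (f := fun a => v a.2) (by fun_prop)
      measurable_snd (hP.1.mono fun _ hz => hz.2),
    (h.hasUniformDeriv_condMass_mul_covVX hv hP).eventually_weight_isBigO,
    h.eventually_condMass_ne_zero, h.eventually_lawZ_absolutelyContinuous]
    with t absCov_isBigO covVX_isBigO mass_ne_zero abs_cont
  obtain ⟨K, hK⟩ := ((absCov_isBigO.trans (absCovVX_isBigO_covVX hP)).trans covVX_isBigO).bound
  refine ⟨K, abs_cont.ae_le ?_⟩
  filter_upwards [hK, mass_ne_zero] with z hz mass_ne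
  rw [norm_mul, norm_mul, mul_left_comm] at hz
  exact (le_abs_self _).trans (le_of_mul_le_mul_left hz (norm_pos_iff.2 mass_ne))

theorem eventually_integrable_absCovVY_div (h : IsDisintegration P s Q p) (hv : Measurable v)
    (hw : Measurable w) (hP : P ∈ lambdaModel v w) :
    ∀ᶠ t in 𝓝 0,
      Integrable (fun z => w z * absCovVY v (Q t) z / covVX v (Q t) z) (lawZ (Q t)) := by
  filter_upwards [h.eventually_condMass_mul_absCov_isBigO (f := fun a => v a.2) (by fun_prop)
      measurable_fst (hP.1.mono fun _ hz => hz.1),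
    ((h.hasUniformDeriv_condMass_mul_covVX hv hP).inv hP.2.1).eventually_isBigO,
    h.hasUniformDeriv_condMass.eventually_isBigO, h.eventually_condMass_ne_zero,
    h.eventually_integrable_lawZ_iff]
    with t absCov_isBigO inv_isBigO mass_isBigO mass_ne_zero iff_t
  refine (iff_t _).2 <| integrable_of_isBigO_ae hP.2.2.2 ((measurable_condMass
    (h.measurable t)).mul ((hw.mul (measurable_absCov _ (by fun_prop) measurable_fst)).div
      (measurable_covVX hv _))).aestronglyMeasurable ?_
  refine (mass_isBigO.mul (((isBigO_refl w _).mul absCov_isBigO).mul inv_isBigO)).congr' ?_ ?_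
  · filter_upwards [mass_ne_zero] with z hz
    rw [← div_eq_mul_inv, mul_left_comm, mul_div_mul_left _ _ hz]
    rfl
  · simp only [one_mul, ← div_eq_mul_inv]
    rfl

theorem eventually_mem_lambdaModel (h : IsDisintegration P s Q p) (hv : Measurable v)
    (hw : Measurable w) (hP : P ∈ lambdaModel v w) : ∀ᶠ t in 𝓝 0, Q t ∈ lambdaModel v w := by
  filter_upwards [h.eventually_condCovExist hP.1, h.eventually_covVX_ne_zero hv hP,
    h.eventually_absCovVX_le hv hP, h.eventually_integrable_absCovVY_div hv hw hP]
    with t covExist ne_zero absCov_le int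
  exact ⟨covExist, ne_zero, absCov_le, int⟩

end IsDisintegration

theorem isInfluenceFunction_phiLambda (hv : Measurable v) (hw : Measurable w)
    (hP : P ∈ lambdaModel v w) (hφ : MemLp (phiLambda v w P) 2 (P : Measure (Obs 𝒵))) :
    IsInfluenceFunction (lambdaModel v w) (lambdaEstimand v w) P (phiLambda v w P) := by
  have φ_int := hφ.integrable one_le_two
  refine ⟨hφ, integral_phiLambda hv hw hP φ_int, fun s Q h => ?_⟩
  obtain ⟨p, hp⟩ := h.exists_isDisintegration
  obtain ⟨B, hB⟩ := h.2.1
  refine ⟨hp.eventually_mem_lambdaModel hv hw hP, ?_⟩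
  rw [integral_phiLambda_mul hP φ_int h.1 hB, integral_sub
    (hp.integrable_weightedEffectDeriv hv hw hP) (hp.integrable_scoreMean.const_mul _),
    integral_const_mul, hp.integral_scoreMean, mul_zero, sub_zero]
  exact hp.hasDerivAt_lambdaEstimand hv hw hP

end Lambda

end InfluenceCurves

section Uniqueness

variable {𝒪 : Type*} [MeasurableSpace 𝒪]

theorem isProbabilityMeasure_withDensity_one_add {μ : Measure 𝒪} [IsProbabilityMeasure μ]
    {s : 𝒪 → ℝ} (hs : Integrable s μ) (hs_mean : ∫ o, s o ∂μ = 0) (hs_nonneg : ∀ o, 0 ≤ 1 + s o) :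
    IsProbabilityMeasure (μ.withDensity fun o => ENNReal.ofReal (1 + s o)) := by
  have density_int : Integrable (fun o => 1 + s o) μ := (integrable_const 1).add hs
  constructor
  rw [withDensity_apply _ .univ, setLIntegral_univ,
    ← ofReal_integral_eq_lintegral_ofReal density_int (.of_forall hs_nonneg),
    integral_add (integrable_const 1) hs, hs_mean]
  simp

theorem exists_isSubmodel (P : ProbabilityMeasure 𝒪) {s : 𝒪 → ℝ} (hs : Measurable s) {B : ℝ}
    (hB : ∀ o, |s o| ≤ B) (hs_mean : ∫ o, s o ∂(P : Measure 𝒪) = 0) :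
    ∃ Q : ℝ → ProbabilityMeasure 𝒪, IsSubmodel P s Q := by
  have small : ∀ᶠ t in 𝓝 (0 : ℝ), ∀ o, 0 ≤ 1 + t * s o := by
    have near : ∀ᶠ t in 𝓝 (0 : ℝ), |t| * B < 1 :=
      (by fun_prop : Continuous fun t : ℝ => |t| * B).continuousAt.eventually_lt
        continuousAt_const (by simp)
    filter_upwards [near] with t ht o
    have : |t * s o| ≤ |t| * B := by
      rw [abs_mul]
      exact mul_le_mul_of_nonneg_left (hB o) (abs_nonneg t)
    linarith [neg_le_of_abs_le this]
  have exists_law (t : ℝ) : ∃ Q : ProbabilityMeasure 𝒪, (∀ o, 0 ≤ 1 + t * s o) →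
      (Q : Measure 𝒪) = (P : Measure 𝒪).withDensity fun o => ENNReal.ofReal (1 + t * s o) := by
    by_cases ht : ∀ o, 0 ≤ 1 + t * s o
    · have s_int : Integrable (fun o => t * s o) (P : Measure 𝒪) :=
        (Integrable.of_bound hs.aestronglyMeasurable B (.of_forall hB)).const_mul t
      exact ⟨⟨_, isProbabilityMeasure_withDensity_one_add s_int
        (by rw [integral_const_mul, hs_mean, mul_zero]) ht⟩, fun _ => rfl⟩
    · exact ⟨P, fun h => absurd h ht⟩
  choose Q hQ using exists_law
  refine ⟨Q, hs, ⟨B, hB⟩, fun t o => max (1 + t * s o) 0, fun t => by fun_prop,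
    fun t o => le_max_right _ _, ?_, fun ε hε => ?_⟩
  · filter_upwards [small] with t ht
    simp only [max_eq_left (ht _), hQ t ht]
  · filter_upwards [small] with t ht
    refine .of_forall fun o => ?_
    rw [max_eq_left (ht o), add_sub_cancel_left, sub_self, abs_zero]
    positivity

theorem integral_mul_indicator_sub_const {μ : Measure 𝒪} {φ : 𝒪 → ℝ} (hφ : Integrable φ μ)
    (hφ_mean : ∫ o, φ o ∂μ = 0) {A : Set 𝒪} (hA : MeasurableSet A) (c : ℝ) :
    ∫ o, φ o * (A.indicator 1 o - c) ∂μ = ∫ o in A, φ o ∂μ := by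
  have split (o : 𝒪) : φ o * (A.indicator 1 o - c) = A.indicator φ o - φ o * c := by
    by_cases ho : o ∈ A <;> simp [ho, mul_sub]
  simp only [split]
  rw [integral_sub (hφ.indicator hA) (hφ.mul_const c), integral_indicator hA, integral_mul_const,
    hφ_mean, zero_mul, sub_zero]

variable {M : Set (ProbabilityMeasure 𝒪)} {Ψ : ProbabilityMeasure 𝒪 → ℝ} {P : ProbabilityMeasure 𝒪}
  {φ φ' : 𝒪 → ℝ}

theorem IsInfluenceFunction.ae_eq (h : IsInfluenceFunction M Ψ P φ)
    (h' : IsInfluenceFunction M Ψ P φ') : φ' =ᵐ[(P : Measure 𝒪)] φ := by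
  have φ_int := h.1.integrable one_le_two
  have φ'_int := h'.1.integrable one_le_two
  refine φ'_int.ae_eq_of_forall_setIntegral_eq _ _ φ_int fun A hA _ => ?_
  set c := (P : Measure 𝒪).real A
  have score_bound (o : 𝒪) : |A.indicator (1 : 𝒪 → ℝ) o - c| ≤ 1 + |c| := by
    refine (abs_sub _ _).trans (add_le_add_left ?_ _)
    by_cases ho : o ∈ A <;> simp [ho]
  have indicator_int : Integrable (A.indicator (1 : 𝒪 → ℝ)) (P : Measure 𝒪) :=
    (integrable_const (1 : ℝ)).indicator hA
  have score_mean : ∫ o, A.indicator (1 : 𝒪 → ℝ) o - c ∂(P : Measure 𝒪) = 0 := by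
    rw [integral_sub indicator_int (integrable_const c), integral_indicator_one hA, integral_const,
      probReal_univ, one_smul, sub_self]
  obtain ⟨Q, hQ⟩ := exists_isSubmodel P ((measurable_one.indicator hA).sub_const c) score_bound
    score_mean
  rw [← integral_mul_indicator_sub_const φ_int h.2.1 hA c,
    ← integral_mul_indicator_sub_const φ'_int h'.2.1 hA c]
  exact (h'.2.2 _ Q hQ).2.unique (h.2.2 _ Q hQ).2

theorem IsInfluenceFunction.isTheInfluenceFunction (h : IsInfluenceFunction M Ψ P φ) :
    IsTheInfluenceFunction M Ψ P φ :=
  ⟨h, fun _ h' => h.ae_eq h'⟩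

end Uniqueness

section EstimatingEquations

variable {𝒵 : Type*} (v : ℝ → ℝ)

theorem mean_icLambda_eq_zero_iff (w ρ β m π lam : 𝒵 → ℝ) {n : ℕ} (hn : 0 < n)
    (o : Fin n → Obs 𝒵) (θ : ℝ) :
    (n : ℝ)⁻¹ * ∑ i, icLambda v w ρ β m π lam θ (o i) = 0 ↔
      θ = lambdaHat v w ρ β m π lam o := by
  have n_ne_zero : (n : ℝ) ≠ 0 := by positivity
  have mean_eq : (n : ℝ)⁻¹ * ∑ i, icLambda v w ρ β m π lam θ (o i) =
      lambdaHat v w ρ β m π lam o - θ := by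
    simp only [icLambda, lambdaHat, contrast, Finset.sum_sub_distrib, Finset.sum_const,
      Finset.card_univ, Fintype.card_fin, nsmul_eq_mul, mul_sub, ← sub_sub]
    rw [inv_mul_cancel_left₀ n_ne_zero]
  rw [mean_eq, sub_eq_zero, eq_comm]

theorem sum_icLambdaBar (ρ β m π : 𝒵 → ℝ) (c : ℝ) {n : ℕ} (o : Fin n → Obs 𝒵)
    (hβ : ∀ i, β (o i).2.2 ≠ 0) (θ : ℝ) :
    ∑ i, icLambdaBar v (fun z => β z / c) ρ β m π θ (o i) =
      (∑ i, (v (o i).2.1 - ρ (o i).2.2) * ((o i).1 - m (o i).2.2) -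
        θ * ∑ i, (v (o i).2.1 - ρ (o i).2.2) * ((o i).2.1 - π (o i).2.2)) / c := by
  rw [Finset.mul_sum, ← Finset.sum_sub_distrib, Finset.sum_div]
  refine Finset.sum_congr rfl fun i _ => ?_
  have := hβ i
  rw [icLambdaBar, contrast]
  field_simp
  ring

theorem mean_icLambdaBar_eq_zero_iff (ρ β m π : 𝒵 → ℝ) {c : ℝ} (hc : c ≠ 0) {n : ℕ}
    (o : Fin n → Obs 𝒵) (hβ : ∀ i, β (o i).2.2 ≠ 0)
    (hsum : ∑ i, (v (o i).2.1 - ρ (o i).2.2) * ((o i).2.1 - π (o i).2.2) ≠ 0) (θ : ℝ) :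
    (n : ℝ)⁻¹ * ∑ i, icLambdaBar v (fun z => β z / c) ρ β m π θ (o i) = 0 ↔
      θ = lambdaBarHat v ρ m π o := by
  have n_ne_zero : (n : ℝ) ≠ 0 := by
    rw [Nat.cast_ne_zero]
    rintro rfl
    simp at hsum
  rw [sum_icLambdaBar v ρ β m π c o hβ, lambdaBarHat, eq_div_iff hsum, mul_eq_zero,
    div_eq_zero_iff, sub_eq_zero]
  simp only [inv_eq_zero, n_ne_zero, hc, false_or, or_false]
  exact eq_comm

end EstimatingEquations

end ContrastEffect

theorem mainTheorem5 {𝒵 : Type*} [MeasurableSpace 𝒵] (v : ℝ → ℝ) (hv : Measurable v) :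
    -- the influence function of `E{w(Z) λ(Z)}` for known `w`
    (∀ (w : 𝒵 → ℝ), Measurable w →
      ∀ P : ProbabilityMeasure (ContrastEffect.Obs 𝒵),
        P ∈ ContrastEffect.lambdaModel v w →
        MemLp (ContrastEffect.phiLambda v w P) 2 (P : Measure (ContrastEffect.Obs 𝒵)) →
        ContrastEffect.IsTheInfluenceFunction (ContrastEffect.lambdaModel v w)
          (ContrastEffect.lambdaEstimand v w) P (ContrastEffect.phiLambda v w P)) ∧
    -- `Λ̄` is the estimand with weight proportional to `Cov{v(X), X | Z}`; its influence function
    (∀ P : ProbabilityMeasure (ContrastEffect.Obs 𝒵),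
        P ∈ ContrastEffect.lambdaBarModel v →
        (∀ᵐ z ∂(ContrastEffect.lawZ P), ContrastEffect.covVX v P z ≠ 0) →
        MemLp (ContrastEffect.phiLambdaBar v P) 2 (P : Measure (ContrastEffect.Obs 𝒵)) →
        ∫ z, ContrastEffect.covWeight v P z ∂(ContrastEffect.lawZ P) = 1 ∧
        ContrastEffect.lambdaBarEstimand v P =
          ∫ z, ContrastEffect.covWeight v P z * ContrastEffect.condEffect v P z
            ∂(ContrastEffect.lawZ P) ∧
        ContrastEffect.IsTheInfluenceFunction (ContrastEffect.lambdaBarModel v)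
          (ContrastEffect.lambdaBarEstimand v) P (ContrastEffect.phiLambdaBar v P)) ∧
    -- setting the sample mean of the fitted influence curve to zero gives the estimators
    (∀ (w ρ β m π lam : 𝒵 → ℝ) (n : ℕ), 0 < n → ∀ (o : Fin n → ContrastEffect.Obs 𝒵) (θ : ℝ),
      (n : ℝ)⁻¹ * ∑ i, ContrastEffect.icLambda v w ρ β m π lam θ (o i) = 0 ↔
        θ = ContrastEffect.lambdaHat v w ρ β m π lam o) ∧
    (∀ (ρ β m π : 𝒵 → ℝ) (c : ℝ), c ≠ 0 →
      ∀ (n : ℕ) (o : Fin n → ContrastEffect.Obs 𝒵), (∀ i, β (o i).2.2 ≠ 0) →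
      ∑ i, (v (o i).2.1 - ρ (o i).2.2) * ((o i).2.1 - π (o i).2.2) ≠ 0 → ∀ θ : ℝ,
      ((n : ℝ)⁻¹ * ∑ i, ContrastEffect.icLambdaBar v (fun z => β z / c) ρ β m π θ (o i) = 0 ↔
        θ = ContrastEffect.lambdaBarHat v ρ m π o)) := by
  refine ⟨fun w hw P hP hφ => ?_, fun P hP hβ hφ => ⟨?_, ?_, ?_⟩, ?_, ?_⟩
  · exact (ContrastEffect.isInfluenceFunction_phiLambda hv hw hP hφ).isTheInfluenceFunction
  · exact ContrastEffect.integral_covWeight hP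
  · exact ContrastEffect.lambdaBarEstimand_eq_integral_covWeight_mul_condEffect hβ
  · exact (ContrastEffect.isInfluenceFunction_phiLambdaBar hv hP hβ hφ).isTheInfluenceFunction
  · exact fun w ρ β m π lam _ hn => ContrastEffect.mean_icLambda_eq_zero_iff v w ρ β m π lam hn
  · exact fun ρ β m π _ hc _ => ContrastEffect.mean_icLambdaBar_eq_zero_iff v ρ β m π hc
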